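/- Let $k$ be a field of characteristic $0$, let $q$ be an indeterminate, and let $x,y,u_1,u_2,u_3,u_4,\alpha,\beta\in k(q)$ satisfy $x\neq y$, $x+y=u_3+u_4$ and $xy=u_1u_2$ (for instance, all of them except $u_1,u_4$ may be independent indeterminates belonging to $k$). For $n\ge 1$ put $$P_n(u_1,u_2,u_3,u_4|\alpha,\beta;q)=\sum_{\sigma\in\mathfrak S_n}u_1^{\mathrm V(\sigma)}u_2^{\mathrm M(\sigma)-1}u_3^{\mathrm{da}(\sigma)}u_4^{\mathrm{dd}(\sigma)}\alpha^{\mathrm{lma}(\sigma)-1}\beta^{\mathrm{rma}(\sigma)-1}q^{\mathrm{inv}(\sigma)},$$ where $\mathrm V,\mathrm M,\mathrm{da},\mathrm{dd}$ are the numbers of valleys, peaks, double ascents and double descents of $\sigma=\sigma_1\cdots\sigma_n$ with the convention $\sigma_0=\sigma_{n+1}=0$, and $\mathrm{lma},\mathrm{rma},\mathrm{inv}$ are the numbers of left-to-right maxima, right-to-left maxima and inversions. Let $[n]_q!=\prod_{i=1}^n(1+q+\cdots+q^{i-1})$, $\exp_q(t)=\sum_{n\ge0}t^n/[n]_q!$,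 $$F(x,y,u,q;t)=u_1\frac{\exp_q((x-u)t)-\exp_q((y-u)t)}{x\exp_q((y-u)t)-y\exp_q((x-u)t)},$$ $F(t)=F(x,y,u_4,q;t)$ and $\tilde F(t)=F(x,y,u_3,\tfrac1q;t)$, all regarded as formal power series in $t$ over $k(q)$. For a formal power series $f$ over $k(q)$ and $p\in\{q,1/q\}$, let $$\int_0^t f(z)\,d_pz=t(1-p)\sum_{n\ge0}f(p^nt)\,p^n,$$ where the coefficient of each power of $t$ is summed in the $p$-adic topology of $k(q)$ (that is, as a series in powers of $q$ when $p=q$ and of $1/q$ when $p=1/q$). Then both integrals below exist as formal power series over $k(q)$, and $$\sum_{n\ge0}P_{n+1}(u_1,u_2,u_3,u_4|\alpha,\beta;q)\frac{t^n}{[n]_q!}=\exp\Big(\int_0^t\frac{\ln\big[1-(1-q)z\alpha(u_3+u_2F(zq))\big]^{-1}}{(1-q)z}\,d_qz+\int_0^t\frac{\ln\big[1-(q-1)z\beta(u_4+u_2\tilde F(z))\big]^{-1}}{(1-\frac1q)z}\,d_{\frac1q}z\Big).$$ -/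

import Mathlib

open PowerSeries

noncomputable section

namespace StirlingEulerian

/-! ### Permutation statistics

A permutation of `[n]` is an element of `Equiv.Perm (Fin n)`, positions and values being shifted
by one. -/

/-- The word `σ₁ ⋯ σₙ` with letters in `{1, …, n}`, extended by the boundary condition
`σ₀ = σₙ₊₁ = 0`. -/
def letter {n : ℕ} (σ : Equiv.Perm (Fin n)) (i : ℕ) : ℕ :=
  if h : 1 ≤ i ∧ i ≤ n then (σ ⟨i - 1, by omega⟩ : ℕ) + 1 else 0

/-- The number of peaks. -/
def peaks {n : ℕ} (σ : Equiv.Perm (Fin n)) : ℕ :=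
  ((Finset.Icc 1 n).filter fun i =>
    letter σ (i - 1) < letter σ i ∧ letter σ (i + 1) < letter σ i).card

/-- The number of valleys. -/
def valleys {n : ℕ} (σ : Equiv.Perm (Fin n)) : ℕ :=
  ((Finset.Icc 1 n).filter fun i =>
    letter σ i < letter σ (i - 1) ∧ letter σ i < letter σ (i + 1)).card

/-- The number of double ascents. -/
def doubleAscents {n : ℕ} (σ : Equiv.Perm (Fin n)) : ℕ :=
  ((Finset.Icc 1 n).filter fun i =>
    letter σ (i - 1) < letter σ i ∧ letter σ i < letter σ (i + 1)).card

/-- The number of double descents. -/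
def doubleDescents {n : ℕ} (σ : Equiv.Perm (Fin n)) : ℕ :=
  ((Finset.Icc 1 n).filter fun i =>
    letter σ i < letter σ (i - 1) ∧ letter σ (i + 1) < letter σ i).card

/-- The number of left-to-right maxima. -/
def lma {n : ℕ} (σ : Equiv.Perm (Fin n)) : ℕ :=
  (Finset.univ.filter fun i : Fin n => ∀ j, j < i → σ j < σ i).card

/-- The number of right-to-left maxima. -/
def rma {n : ℕ} (σ : Equiv.Perm (Fin n)) : ℕ :=
  (Finset.univ.filter fun i : Fin n => ∀ j, i < j → σ j < σ i).card

/-- The number of inversions. -/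
def inv {n : ℕ} (σ : Equiv.Perm (Fin n)) : ℕ :=
  (Finset.univ.filter fun p : Fin n × Fin n => p.1 < p.2 ∧ σ p.2 < σ p.1).card

/-- The polynomial `P_n(u₁,u₂,u₃,u₄|α,β;q)`. For `n ≥ 1` every permutation of `[n]` has at least one
peak, one left-to-right maximum and one right-to-left maximum, so no subtraction truncates. -/
def P {K : Type*} [Field K] (n : ℕ) (u₁ u₂ u₃ u₄ α β q : K) : K :=
  ∑ σ : Equiv.Perm (Fin n),
    u₁ ^ valleys σ * u₂ ^ (peaks σ - 1) * u₃ ^ doubleAscents σ * u₄ ^ doubleDescents σ *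
      α ^ (lma σ - 1) * β ^ (rma σ - 1) * q ^ inv σ

/-! ### `q`-series -/

/-- `[n]_q! = ∏_{i=1}^n (1 + q + ⋯ + q^{i-1})`. -/
def qFactorial {K : Type*} [Field K] (q : K) (n : ℕ) : K :=
  ∏ i ∈ Finset.Icc 1 n, ∑ j ∈ Finset.range i, q ^ j

/-- The `q`-exponential generating function `∑_{n ≥ 0} aₙ tⁿ / [n]_q!`. -/
def qEGF {K : Type*} [Field K] (q : K) (a : ℕ → K) : K⟦X⟧ :=
  PowerSeries.mk fun n => a n / qFactorial q n

/-- `exp_q(t) = ∑_{n ≥ 0} tⁿ / [n]_q!`. -/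
def expq {K : Type*} [Field K] (q : K) : K⟦X⟧ :=
  qEGF q fun _ => 1

/-- The power series
`F(x,y,u,q;t) = u₁ (exp_q((x-u)t) - exp_q((y-u)t)) / (x exp_q((y-u)t) - y exp_q((x-u)t))`.
The denominator has constant term `x - y`, so it is invertible as soon as `x ≠ y`. -/
def F {K : Type*} [Field K] (u₁ x y u q : K) : K⟦X⟧ :=
  C u₁ * (rescale (x - u) (expq q) - rescale (y - u) (expq q)) *
    (C x * rescale (y - u) (expq q) - C y * rescale (x - u) (expq q))⁻¹

/-- The quotient `f(z) / z` of a power series `f` with zero constant term. -/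
def divX {K : Type*} [Field K] (f : K⟦X⟧) : K⟦X⟧ :=
  PowerSeries.mk fun n => coeff (n + 1) f

/-- `I(t)` is the Jackson integral `∫₀ᵗ f(z) d_p z = t (1 - p) ∑_{n ≥ 0} f(pⁿ t) pⁿ` with base `p`:
each coefficient (in `t`) of the partial sums of the series on the right converges, for the
valuation `v`, to the corresponding coefficient of `I(t)`. -/
def IsJacksonIntegral {K Γ : Type*} [Field K] [LinearOrderedCommGroupWithZero Γ]
    (v : Valuation K Γ) (p : K) (f I : K⟦X⟧) : Prop :=
  ∀ m : ℕ, ∀ ε : Γ, ε ≠ 0 → ∃ N₀ : ℕ, ∀ N : ℕ, N₀ ≤ N →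
    v (coeff m (X * C (1 - p) * ∑ n ∈ Finset.range N, rescale (p ^ n) f * C (p ^ n)) -
      coeff m I) < ε

/-- Jackson integrals are unique. -/
theorem IsJacksonIntegral.unique {K Γ : Type*} [Field K] [LinearOrderedCommGroupWithZero Γ]
    {v : Valuation K Γ} {p : K} {f I J : K⟦X⟧}
    (hI : IsJacksonIntegral v p f I) (hJ : IsJacksonIntegral v p f J) : I = J := by
  ext m
  by_contra hne
  have h0 : v (coeff m I - coeff m J) ≠ 0 := by
    rw [Valuation.ne_zero_iff]
    exact sub_ne_zero.mpr hne
  obtain ⟨N₁, h₁⟩ := hI m _ h0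
  obtain ⟨N₂, h₂⟩ := hJ m _ h0
  have a := h₁ (max N₁ N₂) (le_max_left _ _)
  have b := h₂ (max N₁ N₂) (le_max_right _ _)
  have c := v.map_sub_lt b a
  rw [sub_sub_sub_cancel_left] at c
  exact lt_irrefl _ c

/-- The `q`-adic valuation of the field `k(q)` of rational functions in the indeterminate `q`. -/
def valZero (k : Type*) [Field k] : Valuation (RatFunc k) (WithZero (Multiplicative ℤ)) :=
  (Polynomial.idealX k).valuation (RatFunc k)

open Classical in
/-- The `q⁻¹`-adic valuation of `k(q)` (the place at infinity). -/
def valInfty (k : Type*) [Field k] : Valuation (RatFunc k) (WithZero (Multiplicative ℤ)) :=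
  RatFunc.inftyValuation k

/-- The first integrand
`ln [1 - (1-q) z α (u₃ + u₂ F(zq))]⁻¹ / ((1-q) z)`, where `F(t) = F(x,y,u₄,q;t)`. -/
def integrand₁ {K : Type*} [Field K] [Algebra ℚ K] (x y u₁ u₂ u₃ u₄ α q : K) : K⟦X⟧ :=
  C (1 - q)⁻¹ * divX (logOf
    (1 - C (1 - q) * X * C α * (C u₃ + C u₂ * rescale q (F u₁ x y u₄ q)))⁻¹)

/-- The second integrand
`ln [1 - (q-1) z β (u₄ + u₂ F̃(z))]⁻¹ / ((1-1/q) z)`, where `F̃(t) = F(x,y,u₃,1/q;t)`. -/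
def integrand₂ {K : Type*} [Field K] [Algebra ℚ K] (x y u₁ u₂ u₃ u₄ β q : K) : K⟦X⟧ :=
  C (1 - q⁻¹)⁻¹ * divX (logOf
    (1 - C (q - 1) * X * C β * (C u₄ + C u₂ * F u₁ x y u₃ q⁻¹))⁻¹)

end StirlingEulerian

end

open PowerSeries

noncomputable section

namespace StirlingEulerian

/-! ### Exponentials and logarithms of power series -/

section ExpLog

variable {K : Type*} [Field K] [Algebra ℚ K]

/-! Cut a permutation of `[n+1]` at its largest letter `M`, as `l₁ M l₂`. The letter `M` is a peak
and a maximum from both sides; the other left-to-right maxima lie in `l₁`, the other right-to-left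
maxima in `l₂`. Inversions are those inside `l₁` and `l₂`, the `|l₂|` pairs starting at `M`, and
pairs depending only on the two letter sets. So the weight factors (`wordWeight_split`). Summing
over the letter sets with their crossings multiplies `q`-exponential generating functions
(`sum_powerset_crossings`), and the left side becomes `A(t) B(qt)`, where `A` and `B` count words
placed between a zero and a large letter, in the two orders.

The same cut gives recursions. If `1 + Φ` counts words between two large letters, then `D Φ = u₁ +
u₄ Φ(qt) + u₃ Φ + u₂ Φ Φ(qt)`, `D A = α A (u₃ + u₂ Φ(qt))`, `D B = β (u₄ + u₂ Φ) B(qt)`, with `D`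
the `q`-derivative. These determine the coefficients, so it is enough to exhibit solutions. `F`
solves the first (`qDeriv_F`). The second reads `A(qt) = A(t) w(t)`, and the third, for `E(t) =
B(qt)`, reads `E(t/q) = E(t) w̃(t)`; both are solved by exponentials of Jackson integrals
(`exp_jacksonIntegral`), with bases `q` and `1/q`. The series `F̃` of the second integrand is `F`
itself (`F_inv`). -/

theorem constantCoeff_exp_subst {f : K⟦X⟧} (hf : constantCoeff f = 0) :
    constantCoeff ((PowerSeries.exp K).subst f) = 1 := by
  have h1 : (PowerSeries.exp K) = (PowerSeries.exp K - 1) + C 1 := by simp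
  have hs := HasSubst.of_constantCoeff_zero' hf
  rw [h1, subst_add hs, subst_C, map_add]
  have := constantCoeff_subst_eq_zero (a := f) hf (PowerSeries.exp K - 1) (by simp)
  erw [this]
  exact (zero_add _).trans (constantCoeff_C (1 : K))

theorem derivative_exp_subst {f : K⟦X⟧} (hf : constantCoeff f = 0) :
    d⁄dX K ((PowerSeries.exp K).subst f) = (PowerSeries.exp K).subst f * d⁄dX K f := by
  rw [derivative_subst (HasSubst.of_constantCoeff_zero' hf), derivative_exp]

/-- A power series with constant term `1` is determined by its logarithmic derivative. -/
theorem eq_of_derivative_eq_mul {f g h : K⟦X⟧} (hf : constantCoeff f = 1)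
    (hg : constantCoeff g = 1) (hf' : d⁄dX K f = f * h) (hg' : d⁄dX K g = g * h) : f = g := by
  have : CharZero K := algebraRat.charZero K
  have hg0 : constantCoeff g ≠ 0 := by simp [hg]
  have hinv : g * g⁻¹ = 1 := PowerSeries.mul_inv_cancel _ hg0
  -- The quotient has zero derivative, which in characteristic zero makes it constant.
  have key : f * g⁻¹ = 1 := by
    refine derivative.ext ?_ (by simp [hf, hg])
    rw [Derivation.leibniz, derivative_inv', hf', hg', derivative_one]
    simp only [smul_eq_mul]
    linear_combination (-f * h * g⁻¹) * hinv
  calc f = f * g⁻¹ * g := by rw [mul_assoc, mul_comm g⁻¹, hinv, mul_one]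
    _ = g := by rw [key, one_mul]

/-- Both sides have logarithmic derivative `f' + g'`. -/
theorem exp_subst_add {f g : K⟦X⟧} (hf : constantCoeff f = 0) (hg : constantCoeff g = 0) :
    (PowerSeries.exp K).subst (f + g) =
      (PowerSeries.exp K).subst f * (PowerSeries.exp K).subst g := by
  have hfg : constantCoeff (f + g) = 0 := by simp [hf, hg]
  refine eq_of_derivative_eq_mul (h := d⁄dX K (f + g)) (constantCoeff_exp_subst hfg) ?_
    (derivative_exp_subst hfg) ?_
  · rw [map_mul, constantCoeff_exp_subst hf, constantCoeff_exp_subst hg, one_mul]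
  · rw [Derivation.leibniz, derivative_exp_subst hf, derivative_exp_subst hg, map_add]
    simp only [smul_eq_mul]
    ring

theorem derivative_logOf {f : K⟦X⟧} (hf : constantCoeff f = 1) :
    f * d⁄dX K (logOf f) = d⁄dX K f := by
  have h0 : constantCoeff (f - 1) = 0 := by simp [hf]
  have hs := HasSubst.of_constantCoeff_zero' h0
  -- `log K` is the series of `ln (1 + X)`, whose derivative is a geometric series; `f - 1` is then
  -- substituted for `X`.
  have hgeom : (1 + X) * d⁄dX K (log K) = 1 := by
    rw [deriv_log]
    ext n
    rw [add_mul, one_mul, map_add]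
    cases n with
    | zero => simp
    | succ n => simp [coeff_succ_X_mul, pow_succ, coeff_one]
  have h2 := congrArg (PowerSeries.subst (f - 1)) hgeom
  rw [subst_mul hs, subst_add hs, subst_X hs] at h2
  have h1 : PowerSeries.subst (f - 1) (1 : K⟦X⟧) = (1 : K⟦X⟧) := by
    rw [← coe_substAlgHom hs, map_one]
  rw [h1, add_sub_cancel] at h2
  rw [logOf_eq, derivative_subst hs, ← mul_assoc, h2, map_sub, derivative_one]
  simp

theorem exp_subst_logOf {f : K⟦X⟧} (hf : constantCoeff f = 1) :
    (PowerSeries.exp K).subst (logOf f) = f := by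
  have h0 := constantCoeff_logOf hf
  exact eq_of_derivative_eq_mul (constantCoeff_exp_subst h0) hf (derivative_exp_subst h0)
    (derivative_logOf hf).symm

theorem rescale_exp_subst (a : K) {f : K⟦X⟧} (hf : constantCoeff f = 0) :
    rescale a ((PowerSeries.exp K).subst f) = (PowerSeries.exp K).subst (rescale a f) := by
  rw [rescale_eq_subst, rescale_eq_subst,
    subst_comp_subst_apply (HasSubst.of_constantCoeff_zero' hf) (HasSubst.smul_X' a)]

end ExpLog

/-! ### The `q`-derivative -/

section QDeriv

variable {K : Type*} [Field K]

theorem constantCoeff_rescale (a : K) (f : K⟦X⟧) :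
    constantCoeff (rescale a f) = constantCoeff f := by
  rw [← coeff_zero_eq_constantCoeff_apply, coeff_rescale]
  simp

theorem rescale_C (a b : K) : rescale a (C b) = C b := by
  ext n
  rw [coeff_rescale, coeff_C]
  split_ifs with h <;> simp [h]

/-- The `q`-derivative `(f(t) - f(qt)) / ((1 - q) t)`. -/
def qDeriv (q : K) (f : K⟦X⟧) : K⟦X⟧ :=
  PowerSeries.mk fun n => (∑ j ∈ Finset.range (n + 1), q ^ j) * coeff (n + 1) f

/-- Links the coefficientwise definition to the difference quotient, without dividing by `X`. -/
theorem one_sub_mul_X_mul_qDeriv (q : K) (f : K⟦X⟧) :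
    C (1 - q) * X * qDeriv q f = f - rescale q f := by
  ext n
  rw [mul_assoc, coeff_C_mul, map_sub, coeff_rescale]
  cases n with
  | zero => simp
  | succ n =>
    rw [coeff_succ_X_mul, qDeriv, coeff_mk]
    have := mul_neg_geom_sum q (n + 1)
    linear_combination (coeff (n + 1) f) * this

theorem C_one_sub_mul_X_ne_zero {q : K} (hq : q ≠ 1) : (C (1 - q) * X : K⟦X⟧) ≠ 0 :=
  mul_ne_zero (fun h => sub_ne_zero.mpr hq.symm (C_injective (h.trans (map_zero C).symm))) X_ne_zero

theorem qDeriv_eq_iff {q : K} (hq : q ≠ 1) {f g : K⟦X⟧} :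
    qDeriv q f = g ↔ f - rescale q f = C (1 - q) * X * g := by
  rw [← one_sub_mul_X_mul_qDeriv]
  exact ⟨fun h => by rw [h], fun h => mul_left_cancel₀ (C_one_sub_mul_X_ne_zero hq) h⟩

/-- The asymmetry matters: the `rescale q` on `g` records the inversions that a maximal letter on
the left makes with every letter on the right. -/
theorem qDeriv_mul {q : K} (hq : q ≠ 1) (f g : K⟦X⟧) :
    qDeriv q (f * g) = f * qDeriv q g + qDeriv q f * rescale q g := by
  rw [qDeriv_eq_iff hq, map_mul]
  linear_combination (-f) * one_sub_mul_X_mul_qDeriv q g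
    - rescale q g * one_sub_mul_X_mul_qDeriv q f

theorem qFactorial_zero (q : K) : qFactorial q 0 = 1 := by simp [qFactorial]

theorem qFactorial_succ (q : K) (n : ℕ) :
    qFactorial q (n + 1) = qFactorial q n * ∑ j ∈ Finset.range (n + 1), q ^ j := by
  rw [qFactorial, qFactorial, Finset.prod_Icc_succ_top (by omega)]

theorem geom_sum_ne_zero' {q : K} (hq : ∀ n, 0 < n → q ^ n ≠ 1) (n : ℕ) :
    ∑ j ∈ Finset.range (n + 1), q ^ j ≠ 0 := by
  intro h
  have := mul_neg_geom_sum q (n + 1)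
  rw [h, mul_zero] at this
  exact hq (n + 1) n.succ_pos (sub_eq_zero.mp this.symm).symm

theorem qFactorial_ne_zero {q : K} (hq : ∀ n, 0 < n → q ^ n ≠ 1) (n : ℕ) :
    qFactorial q n ≠ 0 := by
  induction n with
  | zero => simp [qFactorial_zero]
  | succ n ih => rw [qFactorial_succ]; exact mul_ne_zero ih (geom_sum_ne_zero' hq n)

theorem qFactorial_succ_mul_coeff (q : K) (f : K⟦X⟧) (n : ℕ) :
    qFactorial q (n + 1) * coeff (n + 1) f = qFactorial q n * coeff n (qDeriv q f) := by
  rw [qFactorial_succ, qDeriv, coeff_mk, mul_assoc]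

theorem qDeriv_qEGF {q : K} (hq : ∀ n, 0 < n → q ^ n ≠ 1) (a : ℕ → K) :
    qDeriv q (qEGF q a) = qEGF q fun n => a (n + 1) := by
  ext n
  have h1 := qFactorial_ne_zero hq n
  have h2 := geom_sum_ne_zero' hq n
  rw [qDeriv, qEGF, qEGF, coeff_mk, coeff_mk, coeff_mk, qFactorial_succ]
  field_simp

/-- A power series fixed by `t ↦ qt` is constant. -/
theorem eq_C_of_rescale_eq {q : K} (hq : ∀ n, 0 < n → q ^ n ≠ 1) {f : K⟦X⟧}
    (hf : rescale q f = f) : f = C (constantCoeff f) := by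
  ext n
  cases n with
  | zero => simp
  | succ n =>
    have h := congrArg (coeff (n + 1)) hf
    rw [coeff_rescale] at h
    have h1 : (q ^ (n + 1) - 1) * coeff (n + 1) f = 0 := by linear_combination h
    rcases mul_eq_zero.mp h1 with h2 | h2
    · exact absurd (sub_eq_zero.mp h2) (hq _ n.succ_pos)
    · rw [h2, coeff_C]; simp

end QDeriv

/-! ### The `q`-exponential and the series `F` -/

section Expq

variable {K : Type*} [Field K]

theorem constantCoeff_expq (q : K) : constantCoeff (expq q) = 1 := by
  rw [← coeff_zero_eq_constantCoeff_apply, expq, qEGF, coeff_mk, qFactorial_zero, div_one]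

theorem rescale_expq {q : K} (hq : ∀ n, 0 < n → q ^ n ≠ 1) :
    rescale q (expq q) = expq q * (1 - C (1 - q) * X) := by
  have h : qDeriv q (expq q) = expq q := qDeriv_qEGF hq _
  have := one_sub_mul_X_mul_qDeriv q (expq q)
  rw [h] at this
  linear_combination this

theorem rescale_rescale_expq {q : K} (hq : ∀ n, 0 < n → q ^ n ≠ 1) (a : K) :
    rescale q (rescale a (expq q)) = rescale a (expq q) * (1 - C (1 - q) * X * C a) := by
  rw [rescale_rescale, mul_comm a q, ← rescale_rescale, rescale_expq hq, map_mul, map_sub, map_one,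
    map_mul, rescale_C, rescale_X]
  ring

theorem inv_pow_ne_one {q : K} (hq : ∀ n, 0 < n → q ^ n ≠ 1) (n : ℕ) (hn : 0 < n) :
    q⁻¹ ^ n ≠ 1 := by
  rw [inv_pow]
  exact inv_ne_one.mpr (hq n hn)

/-- Under `t ↦ qt` one factor is multiplied by `1 - (1-q)at` and the other divided by it, so the
product is invariant and hence constant. -/
theorem rescale_neg_expq_inv_mul {q : K} (hq0 : q ≠ 0) (hq : ∀ n, 0 < n → q ^ n ≠ 1) (a : K) :
    rescale (-a) (expq q⁻¹) * rescale a (expq q) = 1 := by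
  have h1 := rescale_rescale_expq (inv_pow_ne_one hq) (-a)
  have h2 : rescale (-a) (expq q⁻¹) = rescale q (rescale (-a) (expq q⁻¹)) *
      (1 - C (1 - q) * X * C a) := by
    have := congrArg (rescale q) h1
    rw [rescale_rescale, inv_mul_cancel₀ hq0, rescale_one, RingHom.id_apply, map_mul] at this
    refine this.trans ?_
    rw [map_sub, map_one, map_mul, map_mul, rescale_C, rescale_C, rescale_X]
    have hc : (C (1 - q⁻¹) * C q : K⟦X⟧) = -C (1 - q) := by
      rw [← map_mul, ← map_neg]
      congr 1
      field_simp
      ring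
    rw [map_neg]
    linear_combination rescale q (rescale (-a) (expq q⁻¹)) * (X * C a) * hc
  have h3 := rescale_rescale_expq hq a
  have h4 := eq_C_of_rescale_eq hq
    (f := rescale (-a) (expq q⁻¹) * rescale a (expq q)) (by
      rw [map_mul, h3]
      nth_rewrite 2 [h2]
      ring)
  rw [h4, map_mul, constantCoeff_rescale, constantCoeff_rescale, constantCoeff_expq,
    constantCoeff_expq, one_mul, map_one]

theorem constantCoeff_F_denom (x y u q : K) :
    constantCoeff (C x * rescale (y - u) (expq q) - C y * rescale (x - u) (expq q)) = x - y := by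
  simp [constantCoeff_rescale, constantCoeff_expq]

theorem constantCoeff_F (u₁ x y u q : K) : constantCoeff (F u₁ x y u q) = 0 := by
  simp [F, constantCoeff_rescale, constantCoeff_expq]

theorem F_mul_denom (u₁ u q : K) {x y : K} (hne : x ≠ y) :
    F u₁ x y u q * (C x * rescale (y - u) (expq q) - C y * rescale (x - u) (expq q)) =
      C u₁ * (rescale (x - u) (expq q) - rescale (y - u) (expq q)) := by
  rw [F, mul_assoc, PowerSeries.inv_mul_cancel, mul_one]
  rw [constantCoeff_F_denom]
  exact sub_ne_zero.mpr hne

/-- The `q`-Riccati equation satisfied by `F(x,y,u₄,q;t)`. -/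
theorem qDeriv_F {q x y u₁ u₂ u₃ u₄ : K} (hq : ∀ n, 0 < n → q ^ n ≠ 1) (hne : x ≠ y)
    (hadd : x + y = u₃ + u₄) (hmul : x * y = u₁ * u₂) :
    qDeriv q (F u₁ x y u₄ q) = C u₁ + C u₄ * rescale q (F u₁ x y u₄ q) +
      C u₃ * F u₁ x y u₄ q + C u₂ * F u₁ x y u₄ q * rescale q (F u₁ x y u₄ q) := by
  have hq1 : q ≠ 1 := by simpa using hq 1 one_pos
  rw [qDeriv_eq_iff hq1]
  obtain rfl : u₃ = x + y - u₄ := by rw [hadd]; ring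
  have h1 := F_mul_denom u₁ u₄ q hne
  have h2 := congrArg (rescale q) h1
  have hd : constantCoeff
      (C x * rescale (y - u₄) (expq q) - C y * rescale (x - u₄) (expq q)) ≠ 0 := by
    rw [constantCoeff_F_denom]
    exact sub_ne_zero.mpr hne
  have hD : C x * rescale (y - u₄) (expq q) - C y * rescale (x - u₄) (expq q) ≠ 0 :=
    fun h => hd (by rw [h, map_zero])
  have hD' : rescale q (C x * rescale (y - u₄) (expq q) - C y * rescale (x - u₄) (expq q)) ≠ 0 :=
    fun h => hd (by rw [← constantCoeff_rescale q, h, map_zero])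
  -- Clearing both denominators leaves a polynomial identity: the rescaled exponentials are the
  -- original ones times linear factors.
  refine mul_right_cancel₀ (mul_ne_zero hD hD') ?_
  simp only [map_mul, map_sub, rescale_C, rescale_rescale_expq hq] at h2 ⊢
  have hm : (C x * C y : K⟦X⟧) = C u₁ * C u₂ := by rw [← map_mul, hmul, map_mul]
  rw [map_add]
  generalize rescale q (F u₁ x y u₄ q) = G' at *
  generalize F u₁ x y u₄ q = G at *
  generalize rescale (x - u₄) (expq q) = A at *
  generalize rescale (y - u₄) (expq q) = B at *
  generalize (C x : K⟦X⟧) = x' at *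
  generalize (C y : K⟦X⟧) = y' at *
  generalize (C u₁ : K⟦X⟧) = v₁ at *
  generalize (C u₂ : K⟦X⟧) = v₂ at *
  generalize (C u₄ : K⟦X⟧) = v₄ at *
  generalize ((C 1 - C q) * X : K⟦X⟧) = s at *
  set A' := A * (1 - s * (x' - v₄)) with hA'
  set B' := B * (1 - s * (y' - v₄)) with hB'
  -- This is the cleared equation with the series replaced by their numerators and `u₁ u₂` by `xy`.
  have key : v₁ * ((A - B) * (x' * B' - y' * A') - (A' - B') * (x' * B - y' * A) -
      s * ((x' * B - y' * A) * (x' * B' - y' * A') + v₄ * (A' - B') * (x' * B - y' * A) +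
        (x' + y' - v₄) * (A - B) * (x' * B' - y' * A') + x' * y' * (A - B) * (A' - B'))) = 0 := by
    rw [hA', hB']; ring
  linear_combination key + (x' * B' - y' * A') * (1 - s * (x' + y' - v₄)) * h1
    - (x' * B - y' * A) * (1 + s * v₄) * h2
    - s * v₂ * (G * (x' * B - y' * A) * h2 + v₁ * (A' - B') * h1)
    + s * v₁ * (A - B) * (A' - B') * hm

/-- The inversion `q ↦ 1/q` exchanges the roles of `u₃` and `u₄`. -/
theorem F_inv {q x y u₁ u₃ u₄ : K} (hq0 : q ≠ 0) (hq : ∀ n, 0 < n → q ^ n ≠ 1) (hne : x ≠ y)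
    (hadd : x + y = u₃ + u₄) : F u₁ x y u₃ q⁻¹ = F u₁ x y u₄ q := by
  have h1 := F_mul_denom u₁ u₄ q hne
  have h2 := F_mul_denom u₁ u₃ q⁻¹ hne
  have hd : constantCoeff
      (C x * rescale (y - u₄) (expq q) - C y * rescale (x - u₄) (expq q)) ≠ 0 := by
    rw [constantCoeff_F_denom]
    exact sub_ne_zero.mpr hne
  refine mul_right_cancel₀
    (b := C x * rescale (y - u₄) (expq q) - C y * rescale (x - u₄) (expq q))
    (fun h => hd (by rw [h, map_zero])) ?_
  have e1 := rescale_neg_expq_inv_mul hq0 hq (x - u₄)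
  have e2 := rescale_neg_expq_inv_mul hq0 hq (y - u₄)
  -- Passing to reciprocals exchanges `x` and `y` along with `u₃` and `u₄`, which leaves the
  -- fraction unchanged.
  rw [show -(x - u₄) = y - u₃ by linear_combination -hadd] at e1
  rw [show -(y - u₄) = x - u₃ by linear_combination -hadd] at e2
  generalize rescale (x - u₄) (expq q) = A at *
  generalize rescale (y - u₄) (expq q) = B at *
  generalize rescale (x - u₃) (expq q⁻¹) = A' at *
  generalize rescale (y - u₃) (expq q⁻¹) = B' at *
  rw [h1]
  linear_combination A * B * h2 +
    (F u₁ x y u₃ q⁻¹ * C y * A + C u₁ * A) * e2 - (F u₁ x y u₃ q⁻¹ * C x * B + C u₁ * B) * e1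

end Expq

/-! ### Jackson integrals -/

section Jackson

variable {K : Type*} [Field K]

/-- The Jackson integral with base `p`, computed coefficientwise. -/
def jacksonIntegral (p : K) (f : K⟦X⟧) : K⟦X⟧ :=
  X * PowerSeries.mk fun m => (1 - p) * coeff m f / (1 - p ^ (m + 1))

theorem constantCoeff_jacksonIntegral (p : K) (f : K⟦X⟧) :
    constantCoeff (jacksonIntegral p f) = 0 := by
  simp [jacksonIntegral]

/-- The telescoped form of the Jackson sum; it is all that the solution of the difference equations
needs, and it involves no valuation. -/
theorem jacksonIntegral_sub_rescale {p : K} (hp : ∀ n, 0 < n → p ^ n ≠ 1) (f : K⟦X⟧) :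
    jacksonIntegral p f - rescale p (jacksonIntegral p f) = X * C (1 - p) * f := by
  ext m
  rw [map_sub, coeff_rescale, mul_assoc, jacksonIntegral]
  cases m with
  | zero => simp
  | succ m =>
    rw [coeff_succ_X_mul, coeff_succ_X_mul, coeff_mk, coeff_C_mul]
    have : 1 - p ^ (m + 1) ≠ 0 := sub_ne_zero.mpr (hp _ m.succ_pos).symm
    field_simp

/-- In each positive degree the partial sums are geometric, so the error after `N` terms is a
constant times `p ^ ((m + 1) * N)`; `MulArchimedean` brings it below any `ε`. -/
theorem isJacksonIntegral_jacksonIntegral {Γ : Type*} [LinearOrderedCommGroupWithZero Γ]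
    [MulArchimedean Γ] (v : Valuation K Γ) {p : K} (hv : v p < 1)
    (hp : ∀ n, 0 < n → p ^ n ≠ 1) (f : K⟦X⟧) :
    IsJacksonIntegral v p f (jacksonIntegral p f) := by
  intro m ε hε
  cases m with
  | zero =>
    refine ⟨0, fun N _ => ?_⟩
    rw [mul_assoc, jacksonIntegral]
    simpa using zero_lt_iff.mpr hε
  | succ m =>
    have hne : 1 - p ^ (m + 1) ≠ 0 := sub_ne_zero.mpr (hp _ m.succ_pos).symm
    set c := (1 - p) * coeff m f / (1 - p ^ (m + 1)) with hc
    have hdiff : ∀ N : ℕ, coeff (m + 1)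
        (X * C (1 - p) * ∑ n ∈ Finset.range N, rescale (p ^ n) f * C (p ^ n)) -
        coeff (m + 1) (jacksonIntegral p f) = -(c * (p ^ (m + 1)) ^ N) := by
      intro N
      rw [mul_assoc, jacksonIntegral, coeff_succ_X_mul, coeff_succ_X_mul, coeff_mk, coeff_C_mul,
        map_sum]
      have hs : ∑ n ∈ Finset.range N, coeff m (rescale (p ^ n) f * C (p ^ n)) =
          coeff m f * ∑ n ∈ Finset.range N, (p ^ (m + 1)) ^ n := by
        rw [Finset.mul_sum]
        refine Finset.sum_congr rfl fun n _ => ?_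
        rw [coeff_mul_C, coeff_rescale]
        ring
      rw [hs, ← hc]
      have hg := mul_neg_geom_sum (p ^ (m + 1)) N
      have h2 : c * (1 - p ^ (m + 1)) = (1 - p) * coeff m f := by
        rw [hc]; field_simp
      linear_combination c * hg - (∑ n ∈ Finset.range N, (p ^ (m + 1)) ^ n) * h2
    simp_rw [hdiff, Valuation.map_neg, map_mul, map_pow]
    rcases eq_or_ne (v c) 0 with h0 | h0
    · exact ⟨0, fun N _ => by rw [h0, zero_mul]; exact zero_lt_iff.mpr hε⟩
    · have hu : (v c)⁻¹ * ε ≠ 0 := mul_ne_zero (inv_ne_zero h0) hε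
      obtain ⟨N₀, hN₀⟩ := exists_pow_lt₀ (pow_lt_one₀ zero_le hv m.succ_ne_zero) (Units.mk0 _ hu)
      refine ⟨N₀, fun N hN => ?_⟩
      have hlt : (v p ^ (m + 1)) ^ N < (v c)⁻¹ * ε :=
        (pow_le_pow_of_le_one zero_le (pow_le_one₀ zero_le hv.le) hN).trans_lt hN₀
      calc v c * (v p ^ (m + 1)) ^ N < v c * ((v c)⁻¹ * ε) :=
            mul_lt_mul_of_pos_left hlt (zero_lt_iff.mpr h0)
        _ = ε := by rw [← mul_assoc, mul_inv_cancel₀ h0, one_mul]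

theorem X_mul_divX {f : K⟦X⟧} (hf : constantCoeff f = 0) : X * divX f = f := by
  ext n
  cases n with
  | zero => simp [hf]
  | succ n => rw [coeff_succ_X_mul, divX, coeff_mk]

end Jackson

/-! ### Solving the linear `q`-difference equations -/

section Exp

variable {K : Type*} [Field K] [Algebra ℚ K]

/-- The integral satisfies `I(t) - I(pt) = ln w⁻¹`, and exponentiating turns this difference into a
ratio. -/
theorem exp_jacksonIntegral {p : K} (hp : ∀ n, 0 < n → p ^ n ≠ 1) {w : K⟦X⟧}
    (hw : constantCoeff w = 1) :
    rescale p ((PowerSeries.exp K).subst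
        (jacksonIntegral p (C (1 - p)⁻¹ * divX (logOf w⁻¹)))) =
      (PowerSeries.exp K).subst (jacksonIntegral p (C (1 - p)⁻¹ * divX (logOf w⁻¹))) * w := by
  set I := jacksonIntegral p (C (1 - p)⁻¹ * divX (logOf w⁻¹)) with hI
  have hI0 : constantCoeff I = 0 := constantCoeff_jacksonIntegral _ _
  have hw1 : constantCoeff w⁻¹ = 1 := by simp [hw]
  have hp1 : 1 - p ≠ 0 := sub_ne_zero.mpr (by simpa using (hp 1 one_pos).symm)
  have hlog : I = rescale p I + logOf w⁻¹ := by
    have h := jacksonIntegral_sub_rescale hp (C (1 - p)⁻¹ * divX (logOf w⁻¹))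
    have h2 : (C (1 - p) * C (1 - p)⁻¹ : K⟦X⟧) = 1 := by
      rw [← map_mul, mul_inv_cancel₀ hp1, map_one]
    have h3 := X_mul_divX (constantCoeff_logOf hw1)
    rw [← hI] at h
    linear_combination h + X * divX (logOf w⁻¹) * h2 + h3
  have hmul : (PowerSeries.exp K).subst I = rescale p ((PowerSeries.exp K).subst I) * w⁻¹ := by
    conv_lhs => rw [hlog]
    rw [exp_subst_add (by rw [constantCoeff_rescale, hI0]) (constantCoeff_logOf hw1),
      exp_subst_logOf hw1, rescale_exp_subst _ hI0]
  conv_rhs => rw [hmul]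
  rw [mul_assoc, PowerSeries.inv_mul_cancel _ (by simp [hw]), mul_one]

theorem qDeriv_exp_integrand₁ {q : K} (hq : ∀ n, 0 < n → q ^ n ≠ 1) (x y u₁ u₂ u₃ u₄ α : K) :
    qDeriv q ((PowerSeries.exp K).subst
        (jacksonIntegral q (integrand₁ x y u₁ u₂ u₃ u₄ α q))) =
      C α * (PowerSeries.exp K).subst (jacksonIntegral q (integrand₁ x y u₁ u₂ u₃ u₄ α q)) *
        (C u₃ + C u₂ * rescale q (F u₁ x y u₄ q)) := by
  rw [qDeriv_eq_iff (by simpa using hq 1 one_pos), integrand₁, exp_jacksonIntegral hq (by simp)]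
  ring

/-- Here `B(t) = E(t/q)` for the exponential `E`, so the equation in `q` for `B` is the base `1/q`
equation for `E`. -/
theorem qDeriv_exp_integrand₂ {q : K} (hq0 : q ≠ 0) (hq : ∀ n, 0 < n → q ^ n ≠ 1)
    {x y u₃ u₄ : K} (u₁ u₂ β : K) (hne : x ≠ y) (hadd : x + y = u₃ + u₄) :
    qDeriv q (rescale q⁻¹ ((PowerSeries.exp K).subst
        (jacksonIntegral q⁻¹ (integrand₂ x y u₁ u₂ u₃ u₄ β q)))) =
      C β * (C u₄ + C u₂ * F u₁ x y u₄ q) * rescale q (rescale q⁻¹ ((PowerSeries.exp K).subst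
        (jacksonIntegral q⁻¹ (integrand₂ x y u₁ u₂ u₃ u₄ β q)))) := by
  rw [qDeriv_eq_iff (by simpa using hq 1 one_pos), rescale_rescale, inv_mul_cancel₀ hq0,
    rescale_one, RingHom.id_apply, integrand₂, F_inv hq0 hq hne hadd,
    exp_jacksonIntegral (inv_pow_ne_one hq) (by simp)]
  rw [map_sub, map_sub]
  ring

end Exp

/-! ### Arrangements of finite sets of letters -/

/-- The words in which each element of `S` occurs exactly once. -/
def arrangements (S : Finset ℕ) : Finset (List ℕ) :=
  ⟨S.val.lists, Multiset.lists_nodup_finset S⟩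

theorem mem_arrangements {S : Finset ℕ} {l : List ℕ} :
    l ∈ arrangements S ↔ S.val = (l : Multiset ℕ) :=
  Multiset.mem_lists_iff _ _

theorem mem_of_mem_arrangements {S : Finset ℕ} {l : List ℕ} (h : l ∈ arrangements S) {x : ℕ} :
    x ∈ l ↔ x ∈ S := by
  rw [← Finset.mem_val, mem_arrangements.mp h, Multiset.mem_coe]

theorem length_of_mem_arrangements {S : Finset ℕ} {l : List ℕ} (h : l ∈ arrangements S) :
    l.length = S.card := by
  rw [Finset.card_def, mem_arrangements.mp h, Multiset.coe_card]

theorem arrangements_empty : arrangements ∅ = {[]} := by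
  ext l
  rw [mem_arrangements, Finset.mem_singleton, Finset.empty_val, eq_comm, Multiset.coe_eq_zero]

theorem append_cons_mem_arrangements {S T : Finset ℕ} {M : ℕ} (hM : M ∉ S) (hT : T ⊆ S)
    {l₁ l₂ : List ℕ} (h₁ : l₁ ∈ arrangements T) (h₂ : l₂ ∈ arrangements (S \ T)) :
    l₁ ++ M :: l₂ ∈ arrangements (insert M S) := by
  rw [mem_arrangements] at *
  rw [Finset.insert_val_of_notMem hM, ← Multiset.coe_add, ← Multiset.cons_coe, ← h₁, ← h₂,
    Multiset.add_cons, Finset.sdiff_val, add_tsub_cancel_of_le (Finset.val_le_iff.mpr hT)]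

theorem exists_of_mem_arrangements_insert {S : Finset ℕ} {M : ℕ} (hM : M ∉ S) {l : List ℕ}
    (h : l ∈ arrangements (insert M S)) :
    ∃ T ⊆ S, ∃ l₁ ∈ arrangements T, ∃ l₂ ∈ arrangements (S \ T), l₁ ++ M :: l₂ = l := by
  have hMl : M ∈ l := (mem_of_mem_arrangements h).mpr (Finset.mem_insert_self _ _)
  obtain ⟨s, t, rfl⟩ := List.append_of_mem hMl
  rw [mem_arrangements, Finset.insert_val_of_notMem hM, ← Multiset.coe_add, ← Multiset.cons_coe,
    Multiset.add_cons, Multiset.cons_inj_right] at h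
  have hle : (s : Multiset ℕ) ≤ S.val := h ▸ Multiset.le_add_right _ _
  -- The subset is the set of letters standing before `M`.
  refine ⟨⟨s, Multiset.nodup_of_le hle S.nodup⟩, Finset.val_le_iff.mp hle, s,
    mem_arrangements.mpr rfl, t, mem_arrangements.mpr ?_, rfl⟩
  rw [Finset.sdiff_val]
  exact (congrArg (· - (s : Multiset ℕ)) h).trans (add_tsub_cancel_left _ _)

theorem eq_of_append_cons_eq {α : Type*} {l₁ l₁' l₂ l₂' : List α} {M : α} (h : M ∉ l₁)
    (h' : M ∉ l₁') (heq : l₁ ++ M :: l₂ = l₁' ++ M :: l₂') : l₁ = l₁' ∧ l₂ = l₂' := by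
  induction l₁ generalizing l₁' with
  | nil =>
    cases l₁' with
    | nil => exact ⟨rfl, (List.cons.inj heq).2⟩
    | cons c l => exact absurd (List.cons.inj heq).1 fun e => h' (e ▸ List.mem_cons_self)
  | cons c l ih =>
    cases l₁' with
    | nil => exact absurd (List.cons.inj heq).1.symm fun e => h (e ▸ List.mem_cons_self)
    | cons c' l' =>
      obtain ⟨h1, h2⟩ := List.cons.inj heq
      obtain ⟨h3, h4⟩ := ih (List.not_mem_of_not_mem_cons h) (List.not_mem_of_not_mem_cons h') h2
      exact ⟨by rw [h1, h3], h4⟩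

/-- Words on `S ∪ {M}` decompose uniquely as `l₁ M l₂`. -/
theorem sum_arrangements_insert {K : Type*} [AddCommMonoid K] {S : Finset ℕ} {M : ℕ} (hM : M ∉ S)
    (φ : List ℕ → K) :
    ∑ l ∈ arrangements (insert M S), φ l =
      ∑ T ∈ S.powerset, ∑ l₁ ∈ arrangements T, ∑ l₂ ∈ arrangements (S \ T),
        φ (l₁ ++ M :: l₂) := by
  simp_rw [← Finset.sum_product']
  rw [Finset.sum_sigma']
  symm
  refine Finset.sum_bij (fun p _ => p.2.1 ++ M :: p.2.2) ?_ ?_ ?_ fun _ _ => rfl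
  · rintro ⟨T, l₁, l₂⟩ h
    simp only [Finset.mem_sigma, Finset.mem_powerset, Finset.mem_product] at h
    exact append_cons_mem_arrangements hM h.1 h.2.1 h.2.2
  · rintro ⟨T, l₁, l₂⟩ h ⟨T', l₁', l₂'⟩ h' heq
    simp only [Finset.mem_sigma, Finset.mem_powerset, Finset.mem_product] at h h' heq
    have hl : ∀ {T l}, T ⊆ S → l ∈ arrangements T → M ∉ l := fun hT hl hMl =>
      hM (hT ((mem_of_mem_arrangements hl).mp hMl))
    have h1 := eq_of_append_cons_eq (hl h.1 h.2.1) (hl h'.1 h'.2.1) heq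
    obtain ⟨rfl, rfl⟩ := h1
    have : T = T' := Finset.val_injective
      ((mem_arrangements.mp h.2.1).trans (mem_arrangements.mp h'.2.1).symm)
    subst this
    rfl
  · intro l hl
    obtain ⟨T, hT, l₁, h₁, l₂, h₂, rfl⟩ := exists_of_mem_arrangements_insert hM hl
    exact ⟨⟨T, l₁, l₂⟩, by simp [hT, h₁, h₂], rfl⟩

/-- All subsets are needed in the hypothesis because the letters on either side of the maximum can
form any subset. -/
theorem strong_induction_on_max {p : Finset ℕ → Prop} (h0 : p ∅)
    (h : ∀ S M, (∀ x ∈ S, x < M) → (∀ T ⊆ S, p T) → p (insert M S)) (S : Finset ℕ) : p S := by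
  induction S using Finset.strongInduction with
  | H S ih =>
    rcases S.eq_empty_or_nonempty with rfl | hS
    · exact h0
    · rw [← Finset.insert_erase (S.max'_mem hS)]
      refine h _ _ (fun x hx => ?_) fun T hT => ih T ?_
      · exact lt_of_le_of_ne (S.le_max' x (Finset.mem_of_mem_erase hx)) (Finset.ne_of_mem_erase hx)
      · exact lt_of_le_of_lt hT (Finset.erase_ssubset (S.max'_mem hS))

/-! ### The `q`-binomial theorem for subsets -/

/-- The number of pairs `(a, b) ∈ T × U` with `b < a`. -/
def crossings (T U : Finset ℕ) : ℕ := ∑ a ∈ T, (U.filter (· < a)).card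

theorem crossings_insert_left {T U : Finset ℕ} {M : ℕ} (hT : M ∉ T) (hU : ∀ x ∈ U, x < M) :
    crossings (insert M T) U = U.card + crossings T U := by
  rw [crossings, Finset.sum_insert hT, Finset.filter_true_of_mem hU, crossings]

theorem crossings_insert_right {T U : Finset ℕ} {M : ℕ} (hT : ∀ x ∈ T, x < M) :
    crossings T (insert M U) = crossings T U := by
  refine Finset.sum_congr rfl fun a ha => ?_
  rw [Finset.filter_insert, if_neg (not_lt.mpr (hT a ha).le)]

/-- Products of `q`-exponential generating functions count pairs of structures on complementary
subsets, weighted by the number of inversions between the two subsets. -/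
theorem sum_powerset_crossings {K : Type*} [Field K] {q : K} (hq : q ≠ 1) (S : Finset ℕ) :
    ∀ f g : K⟦X⟧, ∑ T ∈ S.powerset, q ^ crossings T (S \ T) *
        ((qFactorial q T.card * coeff T.card f) *
          (qFactorial q (S \ T).card * coeff (S \ T).card g)) =
      qFactorial q S.card * coeff S.card (f * g) := by
  induction S using Finset.induction_on_max with
  | empty => intro f g; simp [crossings, qFactorial_zero]
  | insert M S hM ih =>
    intro f g
    have hMS : M ∉ S := fun h => lt_irrefl _ (hM M h)
    rw [Finset.sum_powerset_insert hMS, Finset.card_insert_of_notMem hMS,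
      qFactorial_succ_mul_coeff, qDeriv_mul hq, map_add, mul_add, ← ih, ← ih]
    congr 1
    -- `M` on the right: it creates no crossing and raises the degree taken from `g`.
    · refine Finset.sum_congr rfl fun T hT => ?_
      rw [Finset.mem_powerset] at hT
      have hMT : M ∉ T := fun h => hMS (hT h)
      rw [Finset.insert_sdiff_of_notMem _ hMT, crossings_insert_right fun x hx => hM x (hT hx),
        Finset.card_insert_of_notMem (by simp [hMS]), qFactorial_succ_mul_coeff]
    -- `M` on the left: it crosses all of `S \ T`, and this power of `q` is the rescaling of `g`.
    · refine Finset.sum_congr rfl fun T hT => ?_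
      rw [Finset.mem_powerset] at hT
      have hMT : M ∉ T := fun h => hMS (hT h)
      have hsd : insert M S \ insert M T = S \ T := by
        ext x; simp only [Finset.mem_sdiff, Finset.mem_insert]
        constructor
        · tauto
        · rintro ⟨h1, h2⟩
          exact ⟨Or.inr h1, fun h => h.elim (fun h => hMS (h ▸ h1)) h2⟩
      rw [hsd, crossings_insert_left hMT fun x hx => hM x (Finset.mem_sdiff.mp hx).1,
        Finset.card_insert_of_notMem hMT, qFactorial_succ_mul_coeff, coeff_rescale]
      ring

/-- A convenient form of `sum_powerset_crossings`. -/
theorem sum_powerset_crossings_of_eq {K : Type*} [Field K] {q : K} (hq : q ≠ 1) {S : Finset ℕ}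
    {f g : K⟦X⟧} {a b : Finset ℕ → K}
    (ha : ∀ T ⊆ S, a T = qFactorial q T.card * coeff T.card f)
    (hb : ∀ T ⊆ S, b T = qFactorial q T.card * coeff T.card g) :
    ∑ T ∈ S.powerset, q ^ crossings T (S \ T) * (a T * b (S \ T)) =
      qFactorial q S.card * coeff S.card (f * g) := by
  rw [← sum_powerset_crossings hq]
  refine Finset.sum_congr rfl fun T hT => ?_
  rw [ha T (Finset.mem_powerset.mp hT), hb _ Finset.sdiff_subset]

/-! ### Statistics on words -/

/-- The number of consecutive triples of letters satisfying `p`. -/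
def tripleCount (p : ℕ → ℕ → ℕ → Prop) [∀ a b c, Decidable (p a b c)] : List ℕ → ℕ
  | a :: b :: c :: l => (if p a b c then 1 else 0) + tripleCount p (b :: c :: l)
  | _ => 0

/-- The number of left-to-right maxima exceeding `m`. -/
def lmaWord (m : ℕ) : List ℕ → ℕ
  | [] => 0
  | c :: l => (if m < c then 1 else 0) + lmaWord (max m c) l

/-- The number of right-to-left maxima. -/
def rmaWord : List ℕ → ℕ
  | [] => 0
  | c :: l => (if ∀ d ∈ l, d < c then 1 else 0) + rmaWord l

/-- The number of inversions. -/
def invWord : List ℕ → ℕ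
  | [] => 0
  | c :: l => l.countP (· < c) + invWord l

/-- Triples are sorted by whether their middle letter is before, at or after the displayed `M`;
hence `M` is the last letter of one piece and the first of the other. -/
theorem tripleCount_append (p : ℕ → ℕ → ℕ → Prop) [∀ a b c, Decidable (p a b c)] (a M b : ℕ)
    (s t : List ℕ) :
    tripleCount p (s ++ a :: M :: b :: t) =
      tripleCount p (s ++ [a, M]) + (if p a M b then 1 else 0) + tripleCount p (M :: b :: t) := by
  induction s with
  | nil => simp [tripleCount]
  | cons x s ih =>
    cases s with
    | nil => simp [tripleCount]; ring
    | cons y s =>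
      cases s with
      | nil => simp only [List.cons_append, List.nil_append, tripleCount] at ih ⊢; omega
      | cons z s => simp only [List.cons_append, tripleCount] at ih ⊢; omega

/-- Splitting a word at a letter `M`; `a` and `b` are the neighbours of `M`. -/
theorem exists_tripleCount_split (a₀ b₀ M : ℕ) (l₁ l₂ : List ℕ) :
    ∃ a b, (l₁ = [] → a = a₀) ∧ (l₁ ≠ [] → a ∈ l₁) ∧ (l₂ = [] → b = b₀) ∧ (l₂ ≠ [] → b ∈ l₂) ∧
      ∀ (p : ℕ → ℕ → ℕ → Prop) [∀ a b c, Decidable (p a b c)],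
        tripleCount p (a₀ :: ((l₁ ++ M :: l₂) ++ [b₀])) =
          tripleCount p (a₀ :: (l₁ ++ [M])) + (if p a M b then 1 else 0) +
            tripleCount p (M :: (l₂ ++ [b₀])) := by
  obtain ⟨s, a, hs, ha, ha'⟩ : ∃ s a, a₀ :: l₁ = s ++ [a] ∧ (l₁ = [] → a = a₀) ∧
      (l₁ ≠ [] → a ∈ l₁) := by
    rcases List.eq_nil_or_concat l₁ with rfl | ⟨s, a, rfl⟩
    · exact ⟨[], a₀, by simp⟩
    · exact ⟨a₀ :: s, a, by simp⟩
  obtain ⟨t, b, ht, hb, hb'⟩ : ∃ t b, l₂ ++ [b₀] = b :: t ∧ (l₂ = [] → b = b₀) ∧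
      (l₂ ≠ [] → b ∈ l₂) := by
    cases l₂ with
    | nil => exact ⟨[], b₀, by simp⟩
    | cons b t => exact ⟨t ++ [b₀], b, by simp⟩
  refine ⟨a, b, ha, ha', hb, hb', fun p _ => ?_⟩
  have h1 : a₀ :: ((l₁ ++ M :: l₂) ++ [b₀]) = s ++ a :: M :: b :: t := by
    rw [List.append_assoc, ← List.cons_append, hs, List.cons_append, ht, List.append_assoc]
    rfl
  have h2 : a₀ :: (l₁ ++ [M]) = s ++ [a, M] := by
    rw [← List.cons_append, hs, List.append_assoc]
    rfl
  rw [h1, h2, ht, tripleCount_append]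

theorem lmaWord_eq_zero {m : ℕ} {l : List ℕ} (h : ∀ x ∈ l, x < m) : lmaWord m l = 0 := by
  induction l with
  | nil => rfl
  | cons c l ih =>
    have hc := h c List.mem_cons_self
    rw [lmaWord, if_neg (not_lt.mpr hc.le), max_eq_left hc.le,
      ih fun x hx => h x (List.mem_cons_of_mem _ hx)]

theorem lmaWord_append_cons {m M : ℕ} {l₁ l₂ : List ℕ} (hm : m < M) (h₁ : ∀ x ∈ l₁, x < M)
    (h₂ : ∀ x ∈ l₂, x < M) : lmaWord m (l₁ ++ M :: l₂) = lmaWord m l₁ + 1 := by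
  induction l₁ generalizing m with
  | nil => simp only [List.nil_append, lmaWord, if_pos hm, max_eq_right hm.le, lmaWord_eq_zero h₂]
  | cons c l ih =>
    rw [List.cons_append, lmaWord, lmaWord, ih (max_lt hm (h₁ c List.mem_cons_self))
      fun x hx => h₁ x (List.mem_cons_of_mem _ hx)]
    ring

theorem rmaWord_append_cons {M : ℕ} {l₁ l₂ : List ℕ} (h₁ : ∀ x ∈ l₁, x < M)
    (h₂ : ∀ x ∈ l₂, x < M) : rmaWord (l₁ ++ M :: l₂) = rmaWord l₂ + 1 := by
  induction l₁ with
  | nil => rw [List.nil_append, rmaWord, if_pos h₂, add_comm]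
  | cons c l ih =>
    rw [List.cons_append, rmaWord, ih fun x hx => h₁ x (List.mem_cons_of_mem _ hx), if_neg,
      zero_add]
    intro h
    exact absurd (h M (by simp)) (not_lt.mpr (h₁ c List.mem_cons_self).le)

theorem invWord_append (l₁ l₂ : List ℕ) :
    invWord (l₁ ++ l₂) =
      invWord l₁ + invWord l₂ + (l₁.map fun a => l₂.countP (· < a)).sum := by
  induction l₁ with
  | nil => simp [invWord]
  | cons c l ih =>
    simp only [List.cons_append, invWord, ih, List.countP_append, List.map_cons, List.sum_cons]
    ring

/-- `M` is inverted with every letter of `l₂` and none of `l₁`; the remaining mixed inversions do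
not depend on the orderings. -/
theorem invWord_append_cons {T U : Finset ℕ} {M : ℕ} {l₁ l₂ : List ℕ} (hT : ∀ x ∈ T, x < M)
    (hU : ∀ x ∈ U, x < M) (h₁ : l₁ ∈ arrangements T) (h₂ : l₂ ∈ arrangements U) :
    invWord (l₁ ++ M :: l₂) = invWord l₁ + invWord l₂ + U.card + crossings T U := by
  have hc : (l₁.map fun a => (M :: l₂).countP (· < a)).sum = crossings T U := by
    have hcount : ∀ a ∈ l₁, (M :: l₂).countP (· < a) = (U.filter (· < a)).card := by
      intro a ha
      rw [List.countP_cons_of_neg (by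
        simpa using (hT a ((mem_of_mem_arrangements h₁).mp ha)).le), Finset.card_def,
        Finset.filter_val, mem_arrangements.mp h₂, ← Multiset.countP_eq_card_filter,
        Multiset.coe_countP]
    rw [List.map_congr_left hcount, crossings, Finset.sum, mem_arrangements.mp h₁,
      Multiset.map_coe, Multiset.sum_coe]
  have hM : l₂.countP (· < M) = U.card := by
    rw [← length_of_mem_arrangements h₂, List.countP_eq_length]
    intro a ha
    simpa using hU a ((mem_of_mem_arrangements h₂).mp ha)
  rw [invWord_append, hc, invWord, hM]
  ring

/-! ### Weighted sums over words -/

section Weights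

variable {K : Type*} [Field K]

/-- The weight of a word (including its two boundary letters) recording valleys, peaks, double
ascents and double descents. -/
def shape (u₁ u₂ u₃ u₄ : K) (w : List ℕ) : K :=
  u₁ ^ tripleCount (fun a b c => b < a ∧ b < c) w *
    u₂ ^ tripleCount (fun a b c => a < b ∧ c < b) w *
    u₃ ^ tripleCount (fun a b c => a < b ∧ b < c) w *
    u₄ ^ tripleCount (fun a b c => b < a ∧ c < b) w

theorem shape_pair (u₁ u₂ u₃ u₄ : K) (a b : ℕ) : shape u₁ u₂ u₃ u₄ [a, b] = 1 := by
  simp [shape, tripleCount]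

/-- A neighbour of `M` is smaller than `M` unless its side is empty, when it is the boundary letter.
This decides which of the four types `M` has. -/
theorem exists_neighbours {T U : Finset ℕ} {a₀ b₀ M : ℕ} {l₁ l₂ : List ℕ}
    (hT : ∀ x ∈ T, x < M) (hU : ∀ x ∈ U, x < M) (h₁ : l₁ ∈ arrangements T)
    (h₂ : l₂ ∈ arrangements U) :
    ∃ a b, (T = ∅ → a = a₀) ∧ (T ≠ ∅ → a < M) ∧ (U = ∅ → b = b₀) ∧ (U ≠ ∅ → b < M) ∧
      ∀ (p : ℕ → ℕ → ℕ → Prop) [∀ a b c, Decidable (p a b c)],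
        tripleCount p (a₀ :: ((l₁ ++ M :: l₂) ++ [b₀])) =
          tripleCount p (a₀ :: (l₁ ++ [M])) + (if p a M b then 1 else 0) +
            tripleCount p (M :: (l₂ ++ [b₀])) := by
  obtain ⟨a, b, ha, ha', hb, hb', h⟩ := exists_tripleCount_split a₀ b₀ M l₁ l₂
  have key : ∀ {V : Finset ℕ} {l : List ℕ}, l ∈ arrangements V → (l = [] ↔ V = ∅) := by
    intro V l hl
    rw [← List.length_eq_zero_iff, length_of_mem_arrangements hl, Finset.card_eq_zero]
  rw [key h₁] at ha
  rw [key h₂] at hb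
  rw [ne_eq, key h₁] at ha'
  rw [ne_eq, key h₂] at hb'
  exact ⟨a, b, ha, fun h => hT a ((mem_of_mem_arrangements h₁).mp (ha' h)), hb,
    fun h => hU b ((mem_of_mem_arrangements h₂).mp (hb' h)), h⟩

variable {T U : Finset ℕ} {a₀ b₀ M : ℕ} {l₁ l₂ : List ℕ}

theorem shape_split_of_gt_of_gt (u₁ u₂ u₃ u₄ : K) (hT : ∀ x ∈ T, x < M) (hU : ∀ x ∈ U, x < M)
    (h₁ : l₁ ∈ arrangements T) (h₂ : l₂ ∈ arrangements U) (ha : M < a₀) (hb : M < b₀) :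
    shape u₁ u₂ u₃ u₄ (a₀ :: ((l₁ ++ M :: l₂) ++ [b₀])) =
      (if T = ∅ then (if U = ∅ then u₁ else u₄) else (if U = ∅ then u₃ else u₂)) *
        (shape u₁ u₂ u₃ u₄ (a₀ :: (l₁ ++ [M])) * shape u₁ u₂ u₃ u₄ (M :: (l₂ ++ [b₀]))) := by
  obtain ⟨a, b, ha1, ha2, hb1, hb2, h⟩ := exists_neighbours (a₀ := a₀) (b₀ := b₀) hT hU h₁ h₂
  simp only [shape, h]
  by_cases hT0 : T = ∅ <;> by_cases hU0 : U = ∅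
  · obtain rfl := ha1 hT0
    obtain rfl := hb1 hU0
    simp only [hT0, hU0, if_true, ha, hb, ha.not_gt, hb.not_gt, and_self, and_false, false_and,
      if_false]
    ring
  · obtain rfl := ha1 hT0
    have hb := hb2 hU0
    simp only [hT0, hU0, if_true, ha, hb, ha.not_gt, hb.not_gt, and_self, and_false, false_and,
      if_false]
    ring
  · have ha := ha2 hT0
    obtain rfl := hb1 hU0
    simp only [hT0, hU0, if_true, ha, hb, ha.not_gt, hb.not_gt, and_self, and_false, false_and,
      if_false]
    ring
  · have ha := ha2 hT0
    have hb := hb2 hU0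
    simp only [hT0, hU0, if_true, ha, hb, ha.not_gt, hb.not_gt, and_self, and_false, false_and,
      if_false]
    ring

theorem shape_split_of_lt_of_gt (u₁ u₂ u₃ u₄ : K) (hT : ∀ x ∈ T, x < M) (hU : ∀ x ∈ U, x < M)
    (h₁ : l₁ ∈ arrangements T) (h₂ : l₂ ∈ arrangements U) (ha₀ : a₀ < M) (hb : M < b₀) :
    shape u₁ u₂ u₃ u₄ (a₀ :: ((l₁ ++ M :: l₂) ++ [b₀])) =
      (if U = ∅ then u₃ else u₂) *
        (shape u₁ u₂ u₃ u₄ (a₀ :: (l₁ ++ [M])) * shape u₁ u₂ u₃ u₄ (M :: (l₂ ++ [b₀]))) := by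
  obtain ⟨a, b, ha1, ha2, hb1, hb2, h⟩ := exists_neighbours (a₀ := a₀) (b₀ := b₀) hT hU h₁ h₂
  simp only [shape, h]
  have ha : a < M := by
    by_cases hT0 : T = ∅
    · rwa [ha1 hT0]
    · exact ha2 hT0
  by_cases hU0 : U = ∅
  · obtain rfl := hb1 hU0
    simp only [hU0, if_true, ha, hb, ha.not_gt, hb.not_gt, and_self, and_false, false_and,
      if_false]
    ring
  · have hb := hb2 hU0
    simp only [hU0, if_true, ha, hb, ha.not_gt, hb.not_gt, and_self, and_false, false_and,
      if_false]
    ring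

theorem shape_split_of_gt_of_lt (u₁ u₂ u₃ u₄ : K) (hT : ∀ x ∈ T, x < M) (hU : ∀ x ∈ U, x < M)
    (h₁ : l₁ ∈ arrangements T) (h₂ : l₂ ∈ arrangements U) (ha : M < a₀) (hb₀ : b₀ < M) :
    shape u₁ u₂ u₃ u₄ (a₀ :: ((l₁ ++ M :: l₂) ++ [b₀])) =
      (if T = ∅ then u₄ else u₂) *
        (shape u₁ u₂ u₃ u₄ (a₀ :: (l₁ ++ [M])) * shape u₁ u₂ u₃ u₄ (M :: (l₂ ++ [b₀]))) := by
  obtain ⟨a, b, ha1, ha2, hb1, hb2, h⟩ := exists_neighbours (a₀ := a₀) (b₀ := b₀) hT hU h₁ h₂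
  simp only [shape, h]
  have hb : b < M := by
    by_cases hU0 : U = ∅
    · rwa [hb1 hU0]
    · exact hb2 hU0
  by_cases hT0 : T = ∅
  · obtain rfl := ha1 hT0
    simp only [hT0, if_true, ha, hb, ha.not_gt, hb.not_gt, and_self, and_false, false_and,
      if_false]
    ring
  · have ha := ha2 hT0
    simp only [hT0, if_true, ha, hb, ha.not_gt, hb.not_gt, and_self, and_false, false_and,
      if_false]
    ring

/-- The weight of a permutation, written as a word, in the definition of `P`. -/
def wordWeight (u₁ u₂ u₃ u₄ α β q : K) (l : List ℕ) : K :=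
  u₁ ^ tripleCount (fun a b c => b < a ∧ b < c) (0 :: (l ++ [0])) *
    u₂ ^ (tripleCount (fun a b c => a < b ∧ c < b) (0 :: (l ++ [0])) - 1) *
    u₃ ^ tripleCount (fun a b c => a < b ∧ b < c) (0 :: (l ++ [0])) *
    u₄ ^ tripleCount (fun a b c => b < a ∧ c < b) (0 :: (l ++ [0])) *
    α ^ (lmaWord 0 l - 1) * β ^ (rmaWord l - 1) * q ^ invWord l

/-- The contributions of `M` as a peak and as a maximum from each side cancel the three subtractions
of `1` in the exponents. -/
theorem wordWeight_split (u₁ u₂ u₃ u₄ α β q : K) (hT : ∀ x ∈ T, x < M) (hU : ∀ x ∈ U, x < M)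
    (h₁ : l₁ ∈ arrangements T) (h₂ : l₂ ∈ arrangements U) (hM : 0 < M) :
    wordWeight u₁ u₂ u₃ u₄ α β q (l₁ ++ M :: l₂) =
      (q ^ crossings T U * q ^ U.card) *
        ((shape u₁ u₂ u₃ u₄ (0 :: (l₁ ++ [M])) * α ^ lmaWord 0 l₁ * q ^ invWord l₁) *
          (shape u₁ u₂ u₃ u₄ (M :: (l₂ ++ [0])) * β ^ rmaWord l₂ * q ^ invWord l₂)) := by
  obtain ⟨a, b, ha1, ha2, hb1, hb2, h⟩ := exists_neighbours (a₀ := 0) (b₀ := 0) hT hU h₁ h₂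
  have ha : a < M := by
    by_cases hT0 : T = ∅
    · rwa [ha1 hT0]
    · exact ha2 hT0
  have hb : b < M := by
    by_cases hU0 : U = ∅
    · rwa [hb1 hU0]
    · exact hb2 hU0
  have hl₁ : ∀ x ∈ l₁, x < M := fun x hx => hT x ((mem_of_mem_arrangements h₁).mp hx)
  have hl₂ : ∀ x ∈ l₂, x < M := fun x hx => hU x ((mem_of_mem_arrangements h₂).mp hx)
  simp only [wordWeight, shape, h, ha, hb, ha.not_gt, hb.not_gt, and_self, and_false, false_and,
    if_false, if_true, lmaWord_append_cons hM hl₁ hl₂, rmaWord_append_cons hl₁ hl₂,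
    invWord_append_cons hT hU h₁ h₂, add_tsub_cancel_right, add_zero, add_right_comm _ 1]
  ring

theorem sum_sum_arrangements_eq {φ L R : List ℕ → K} {c : K}
    (h : ∀ l₁ ∈ arrangements T, ∀ l₂ ∈ arrangements U, φ (l₁ ++ M :: l₂) = c * (L l₁ * R l₂)) :
    ∑ l₁ ∈ arrangements T, ∑ l₂ ∈ arrangements U, φ (l₁ ++ M :: l₂) =
      c * ((∑ l ∈ arrangements T, L l) * ∑ l ∈ arrangements U, R l) := by
  rw [Finset.sum_mul_sum, Finset.mul_sum]
  refine Finset.sum_congr rfl fun l₁ h₁ => ?_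
  rw [Finset.mul_sum]
  exact Finset.sum_congr rfl fun l₂ h₂ => h l₁ h₁ l₂ h₂

/-- Translates a separate weight for the empty side into a constant term. -/
theorem ite_eq_qFactorial_mul_coeff {q : K} {Φ : K⟦X⟧} (hΦ : constantCoeff Φ = 0) {g : K}
    (hg : g = qFactorial q T.card * coeff T.card (1 + Φ)) (c d : K) :
    (if T = ∅ then c else d * g) = qFactorial q T.card * coeff T.card (C c + C d * Φ) := by
  split_ifs with h
  · simp [h, qFactorial_zero, hΦ]
  · have hc : T.card ≠ 0 := by rwa [ne_eq, Finset.card_eq_zero]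
    rw [hg, map_add, map_add, coeff_C_mul, coeff_C, coeff_one, if_neg hc, if_neg hc]
    ring

theorem qDeriv_one_add (q : K) (Φ : K⟦X⟧) : qDeriv q (1 + Φ) = qDeriv q Φ := by
  ext n
  simp [qDeriv, coeff_one]

/-! ### Generating functions of words with prescribed boundary letters -/

section Sums

variable {q u₁ u₂ u₃ u₄ : K} {Φ : K⟦X⟧}

/-- Words between two boundary letters larger than all letters. -/
theorem sum_shape_of_gt_of_gt (hq : q ≠ 1) (hΦ : constantCoeff Φ = 0)
    (hΦ' : qDeriv q Φ = C u₁ + C u₄ * rescale q Φ + C u₃ * Φ + C u₂ * Φ * rescale q Φ)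
    (S : Finset ℕ) : ∀ a b : ℕ, (∀ x ∈ S, x < a) → (∀ x ∈ S, x < b) →
    ∑ l ∈ arrangements S, shape u₁ u₂ u₃ u₄ (a :: (l ++ [b])) * q ^ invWord l =
      qFactorial q S.card * coeff S.card (1 + Φ) := by
  induction S using strong_induction_on_max with
  | h0 =>
    intro a b _ _
    simp [arrangements_empty, shape_pair, invWord, qFactorial_zero, hΦ]
  | h S M hM ih =>
    intro a b ha hb
    have hMS : M ∉ S := fun h => lt_irrefl _ (hM M h)
    have haM := ha M (Finset.mem_insert_self _ _)
    have hbM := hb M (Finset.mem_insert_self _ _)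
    set G : Finset ℕ → K := fun T => qFactorial q T.card * coeff T.card (1 + Φ) with hG
    -- The weight of `M` depends jointly on which sides are empty, so it is not a product.
    -- Separating `T = ∅` from `T ≠ ∅` gives two products, with series `1 · (u₁ + u₄ Φ(qt))` and `Φ
    -- · (u₃ + u₂ Φ(qt))`.
    have key : ∀ T ∈ S.powerset, ∑ l₁ ∈ arrangements T, ∑ l₂ ∈ arrangements (S \ T),
        shape u₁ u₂ u₃ u₄ (a :: ((l₁ ++ M :: l₂) ++ [b])) * q ^ invWord (l₁ ++ M :: l₂) =
        q ^ crossings T (S \ T) * ((if T = ∅ then 1 else 0 * G T) *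
          (q ^ (S \ T).card * if S \ T = ∅ then u₁ else u₄ * G (S \ T))) +
        q ^ crossings T (S \ T) * ((if T = ∅ then 0 else 1 * G T) *
          (q ^ (S \ T).card * if S \ T = ∅ then u₃ else u₂ * G (S \ T))) := by
      intro T hT
      rw [Finset.mem_powerset] at hT
      have hTM : ∀ x ∈ T, x < M := fun x hx => hM x (hT hx)
      have hUM : ∀ x ∈ S \ T, x < M := fun x hx => hM x (Finset.sdiff_subset hx)
      rw [sum_sum_arrangements_eq
        (φ := fun l => shape u₁ u₂ u₃ u₄ (a :: (l ++ [b])) * q ^ invWord l)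
        (L := fun l => shape u₁ u₂ u₃ u₄ (a :: (l ++ [M])) * q ^ invWord l)
        (R := fun l => shape u₁ u₂ u₃ u₄ (M :: (l ++ [b])) * q ^ invWord l)
        (c := q ^ crossings T (S \ T) * q ^ (S \ T).card *
          if T = ∅ then (if S \ T = ∅ then u₁ else u₄) else (if S \ T = ∅ then u₃ else u₂)) ?_,
        ih T hT a M (fun x hx => (hTM x hx).trans haM) hTM,
        ih (S \ T) Finset.sdiff_subset M b hUM (fun x hx => (hUM x hx).trans hbM)]
      · have h0 : ∀ V : Finset ℕ, V = ∅ → G V = 1 := by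
          rintro V rfl
          simp [hG, qFactorial_zero, hΦ]
        change _ * (G T * G (S \ T)) = _
        split_ifs with h1 h2 h2
        · rw [h0 _ h1, h0 _ h2]; ring
        · rw [h0 _ h1]; ring
        · rw [h0 _ h2]; ring
        · ring
      · intro l₁ h₁ l₂ h₂
        simp only [shape_split_of_gt_of_gt u₁ u₂ u₃ u₄ hTM hUM h₁ h₂ haM hbM,
          invWord_append_cons hTM hUM h₁ h₂, pow_add]
        ring
    have hres : ∀ (c d : K), ∀ T ⊆ S, q ^ T.card * (if T = ∅ then c else d * G T) =
        qFactorial q T.card * coeff T.card (rescale q (C c + C d * Φ)) := by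
      intro c d T _
      rw [ite_eq_qFactorial_mul_coeff hΦ (show G T = _ from rfl) c d, coeff_rescale]
      ring
    rw [sum_arrangements_insert hMS, Finset.sum_congr rfl key, Finset.sum_add_distrib,
      sum_powerset_crossings_of_eq hq
        (fun T _ => ite_eq_qFactorial_mul_coeff hΦ (show G T = _ from rfl) 1 0) (hres u₁ u₄),
      sum_powerset_crossings_of_eq hq
        (fun T _ => ite_eq_qFactorial_mul_coeff hΦ (show G T = _ from rfl) 0 1) (hres u₃ u₂),
      Finset.card_insert_of_notMem hMS, qFactorial_succ_mul_coeff, qDeriv_one_add, hΦ', ← mul_add,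
      ← map_add]
    congr 2
    simp only [map_add, map_mul, map_one, map_zero, rescale_C]
    ring

/-- Words between a small left boundary letter and a large right boundary letter. -/
theorem sum_shape_of_lt_of_gt (hq : q ≠ 1) (hΦ : constantCoeff Φ = 0)
    (hΦ' : qDeriv q Φ = C u₁ + C u₄ * rescale q Φ + C u₃ * Φ + C u₂ * Φ * rescale q Φ)
    {α : K} {A : K⟦X⟧} (hA : constantCoeff A = 1)
    (hA' : qDeriv q A = C α * A * (C u₃ + C u₂ * rescale q Φ)) (S : Finset ℕ) :
    (∀ x ∈ S, 0 < x) → ∀ b : ℕ, (∀ x ∈ S, x < b) →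
    ∑ l ∈ arrangements S, shape u₁ u₂ u₃ u₄ (0 :: (l ++ [b])) * α ^ lmaWord 0 l * q ^ invWord l =
      qFactorial q S.card * coeff S.card A := by
  induction S using strong_induction_on_max with
  | h0 =>
    intro _ b _
    simp [arrangements_empty, shape_pair, invWord, lmaWord, qFactorial_zero, hA]
  | h S M hM ih =>
    intro hpos b hb
    have hMS : M ∉ S := fun h => lt_irrefl _ (hM M h)
    have hM0 := hpos M (Finset.mem_insert_self _ _)
    have hbM := hb M (Finset.mem_insert_self _ _)
    -- The right part now lies between two large letters and contributes to `Φ`; the factor `α` is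
    -- for `M` itself.
    have key : ∀ T ∈ S.powerset, ∑ l₁ ∈ arrangements T, ∑ l₂ ∈ arrangements (S \ T),
        shape u₁ u₂ u₃ u₄ (0 :: ((l₁ ++ M :: l₂) ++ [b])) * α ^ lmaWord 0 (l₁ ++ M :: l₂) *
          q ^ invWord (l₁ ++ M :: l₂) =
        q ^ crossings T (S \ T) * ((qFactorial q T.card * coeff T.card (C α * A)) *
          (q ^ (S \ T).card * if S \ T = ∅ then u₃ else u₂ *
            (qFactorial q (S \ T).card * coeff (S \ T).card (1 + Φ)))) := by
      intro T hT
      rw [Finset.mem_powerset] at hT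
      have hTM : ∀ x ∈ T, x < M := fun x hx => hM x (hT hx)
      have hUM : ∀ x ∈ S \ T, x < M := fun x hx => hM x (Finset.sdiff_subset hx)
      rw [sum_sum_arrangements_eq
        (φ := fun l => shape u₁ u₂ u₃ u₄ (0 :: (l ++ [b])) * α ^ lmaWord 0 l * q ^ invWord l)
        (L := fun l => shape u₁ u₂ u₃ u₄ (0 :: (l ++ [M])) * α ^ lmaWord 0 l * q ^ invWord l)
        (R := fun l => shape u₁ u₂ u₃ u₄ (M :: (l ++ [b])) * q ^ invWord l)
        (c := q ^ crossings T (S \ T) * q ^ (S \ T).card * α * if S \ T = ∅ then u₃ else u₂) ?_,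
        ih T hT (fun x hx => hpos x (Finset.mem_insert_of_mem (hT hx))) M hTM,
        sum_shape_of_gt_of_gt hq hΦ hΦ' (S \ T) M b hUM (fun x hx => (hUM x hx).trans hbM),
        coeff_C_mul]
      · split_ifs with h2
        · simp only [h2, Finset.card_empty, qFactorial_zero, coeff_zero_eq_constantCoeff, map_add,
            hΦ, constantCoeff_one]
          ring
        · ring
      · intro l₁ h₁ l₂ h₂
        simp only [shape_split_of_lt_of_gt u₁ u₂ u₃ u₄ hTM hUM h₁ h₂ hM0 hbM,
          invWord_append_cons hTM hUM h₁ h₂, pow_add, lmaWord_append_cons hM0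
          (fun x hx => hTM x ((mem_of_mem_arrangements h₁).mp hx))
          (fun x hx => hUM x ((mem_of_mem_arrangements h₂).mp hx))]
        ring
    have hres : ∀ T ⊆ S, q ^ T.card * (if T = ∅ then u₃ else u₂ *
          (qFactorial q T.card * coeff T.card (1 + Φ))) =
        qFactorial q T.card * coeff T.card (rescale q (C u₃ + C u₂ * Φ)) := by
      intro T _
      rw [ite_eq_qFactorial_mul_coeff hΦ rfl, coeff_rescale]
      ring
    rw [sum_arrangements_insert hMS, Finset.sum_congr rfl key,
      sum_powerset_crossings_of_eq (a := fun T => qFactorial q T.card * coeff T.card (C α * A))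
        (b := fun T => q ^ T.card * if T = ∅ then u₃ else u₂ *
          (qFactorial q T.card * coeff T.card (1 + Φ))) hq (fun _ _ => rfl) hres,
      Finset.card_insert_of_notMem hMS, qFactorial_succ_mul_coeff, hA', map_add (rescale q),
      map_mul (rescale q), rescale_C, rescale_C]

/-- Words between a large left boundary letter and a small right boundary letter. -/
theorem sum_shape_of_gt_of_lt (hq : q ≠ 1) (hΦ : constantCoeff Φ = 0)
    (hΦ' : qDeriv q Φ = C u₁ + C u₄ * rescale q Φ + C u₃ * Φ + C u₂ * Φ * rescale q Φ)
    {β : K} {B : K⟦X⟧} (hB : constantCoeff B = 1)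
    (hB' : qDeriv q B = C β * (C u₄ + C u₂ * Φ) * rescale q B) (S : Finset ℕ) :
    (∀ x ∈ S, 0 < x) → ∀ a : ℕ, (∀ x ∈ S, x < a) →
    ∑ l ∈ arrangements S, shape u₁ u₂ u₃ u₄ (a :: (l ++ [0])) * β ^ rmaWord l * q ^ invWord l =
      qFactorial q S.card * coeff S.card B := by
  induction S using strong_induction_on_max with
  | h0 =>
    intro _ a _
    simp [arrangements_empty, shape_pair, invWord, rmaWord, qFactorial_zero, hB]
  | h S M hM ih =>
    intro hpos a ha
    have hMS : M ∉ S := fun h => lt_irrefl _ (hM M h)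
    have hM0 := hpos M (Finset.mem_insert_self _ _)
    have haM := ha M (Finset.mem_insert_self _ _)
    -- Now the left part contributes to `Φ`, and the power of `q` coming from `M` rescales `B`
    -- instead.
    have key : ∀ T ∈ S.powerset, ∑ l₁ ∈ arrangements T, ∑ l₂ ∈ arrangements (S \ T),
        shape u₁ u₂ u₃ u₄ (a :: ((l₁ ++ M :: l₂) ++ [0])) * β ^ rmaWord (l₁ ++ M :: l₂) *
          q ^ invWord (l₁ ++ M :: l₂) =
        q ^ crossings T (S \ T) * ((β * if T = ∅ then u₄ else u₂ *
            (qFactorial q T.card * coeff T.card (1 + Φ))) *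
          (q ^ (S \ T).card * (qFactorial q (S \ T).card * coeff (S \ T).card B))) := by
      intro T hT
      rw [Finset.mem_powerset] at hT
      have hTM : ∀ x ∈ T, x < M := fun x hx => hM x (hT hx)
      have hUM : ∀ x ∈ S \ T, x < M := fun x hx => hM x (Finset.sdiff_subset hx)
      rw [sum_sum_arrangements_eq
        (φ := fun l => shape u₁ u₂ u₃ u₄ (a :: (l ++ [0])) * β ^ rmaWord l * q ^ invWord l)
        (L := fun l => shape u₁ u₂ u₃ u₄ (a :: (l ++ [M])) * q ^ invWord l)
        (R := fun l => shape u₁ u₂ u₃ u₄ (M :: (l ++ [0])) * β ^ rmaWord l * q ^ invWord l)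
        (c := q ^ crossings T (S \ T) * q ^ (S \ T).card * β * if T = ∅ then u₄ else u₂) ?_,
        ih (S \ T) Finset.sdiff_subset
          (fun x hx => hpos x (Finset.mem_insert_of_mem (Finset.sdiff_subset hx))) M hUM,
        sum_shape_of_gt_of_gt hq hΦ hΦ' T a M (fun x hx => (hTM x hx).trans haM) hTM]
      · split_ifs with h2
        · simp only [h2, Finset.card_empty, qFactorial_zero, coeff_zero_eq_constantCoeff, map_add,
            hΦ, constantCoeff_one]
          ring
        · ring
      · intro l₁ h₁ l₂ h₂
        simp only [shape_split_of_gt_of_lt u₁ u₂ u₃ u₄ hTM hUM h₁ h₂ haM hM0,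
          invWord_append_cons hTM hUM h₁ h₂, pow_add, rmaWord_append_cons
          (fun x hx => hTM x ((mem_of_mem_arrangements h₁).mp hx))
          (fun x hx => hUM x ((mem_of_mem_arrangements h₂).mp hx))]
        ring
    have hleft : ∀ T ⊆ S, (β * if T = ∅ then u₄ else u₂ *
          (qFactorial q T.card * coeff T.card (1 + Φ))) =
        qFactorial q T.card * coeff T.card (C β * (C u₄ + C u₂ * Φ)) := by
      intro T _
      rw [ite_eq_qFactorial_mul_coeff hΦ rfl, coeff_C_mul]
      ring
    have hright : ∀ T ⊆ S, q ^ T.card * (qFactorial q T.card * coeff T.card B) =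
        qFactorial q T.card * coeff T.card (rescale q B) := by
      intro T _
      rw [coeff_rescale]
      ring
    rw [sum_arrangements_insert hMS, Finset.sum_congr rfl key,
      sum_powerset_crossings_of_eq (a := fun T => β * if T = ∅ then u₄ else u₂ *
          (qFactorial q T.card * coeff T.card (1 + Φ)))
        (b := fun T => q ^ T.card * (qFactorial q T.card * coeff T.card B)) hq hleft hright,
      Finset.card_insert_of_notMem hMS, qFactorial_succ_mul_coeff, hB']

/-- Words between two boundary letters `0`. -/
theorem sum_wordWeight (hq : q ≠ 1) (hΦ : constantCoeff Φ = 0)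
    (hΦ' : qDeriv q Φ = C u₁ + C u₄ * rescale q Φ + C u₃ * Φ + C u₂ * Φ * rescale q Φ)
    {α β : K} {A B : K⟦X⟧} (hA : constantCoeff A = 1)
    (hA' : qDeriv q A = C α * A * (C u₃ + C u₂ * rescale q Φ)) (hB : constantCoeff B = 1)
    (hB' : qDeriv q B = C β * (C u₄ + C u₂ * Φ) * rescale q B) {S : Finset ℕ} {M : ℕ}
    (hM : ∀ x ∈ S, x < M) (hM0 : 0 < M) (hpos : ∀ x ∈ S, 0 < x) :
    ∑ l ∈ arrangements (insert M S), wordWeight u₁ u₂ u₃ u₄ α β q l =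
      qFactorial q S.card * coeff S.card (A * rescale q B) := by
  have hMS : M ∉ S := fun h => lt_irrefl _ (hM M h)
  rw [sum_arrangements_insert hMS, ← sum_powerset_crossings hq]
  refine Finset.sum_congr rfl fun T hT => ?_
  rw [Finset.mem_powerset] at hT
  have hTM : ∀ x ∈ T, x < M := fun x hx => hM x (hT hx)
  have hUM : ∀ x ∈ S \ T, x < M := fun x hx => hM x (Finset.sdiff_subset hx)
  rw [sum_sum_arrangements_eq fun l₁ h₁ l₂ h₂ =>
      wordWeight_split u₁ u₂ u₃ u₄ α β q hTM hUM h₁ h₂ hM0,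
    sum_shape_of_lt_of_gt hq hΦ hΦ' hA hA' T (fun x hx => hpos x (hT hx)) M hTM,
    sum_shape_of_gt_of_lt hq hΦ hΦ' hB hB' (S \ T)
      (fun x hx => hpos x (Finset.sdiff_subset hx)) M hUM, coeff_rescale]
  ring

end Sums

end Weights

/-! ### Permutations as words -/

/-- The word of a permutation, with letters `1, …, n`. -/
def permWord {n : ℕ} (σ : Equiv.Perm (Fin n)) : List ℕ := List.ofFn fun i => (σ i : ℕ) + 1

theorem permWord_mem_arrangements {n : ℕ} (σ : Equiv.Perm (Fin n)) :
    permWord σ ∈ arrangements (Finset.Icc 1 n) := by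
  rw [mem_arrangements]
  have hnd : (permWord σ).Nodup := by
    rw [permWord, List.nodup_ofFn]
    intro i j h
    exact σ.injective (Fin.ext (Nat.succ_injective h))
  rw [Multiset.Nodup.ext (Finset.nodup _) (Multiset.coe_nodup.mpr hnd)]
  intro a
  rw [Finset.mem_val, Finset.mem_Icc, Multiset.mem_coe, permWord, List.mem_ofFn']
  constructor
  · rintro ⟨h1, h2⟩
    exact ⟨σ.symm ⟨a - 1, by omega⟩, by simp; omega⟩
  · rintro ⟨i, rfl⟩
    have := (σ i).isLt
    constructor <;> dsimp only <;> omega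

theorem permWord_injective {n : ℕ} : Function.Injective (permWord (n := n)) := by
  intro σ τ h
  have h' := List.ofFn_injective h
  ext i
  exact Nat.succ_injective (congrFun h' i)

theorem exists_permWord_eq {n : ℕ} {l : List ℕ} (hl : l ∈ arrangements (Finset.Icc 1 n)) :
    ∃ σ : Equiv.Perm (Fin n), permWord σ = l := by
  have hn : l.length = n := by rw [length_of_mem_arrangements hl]; simp
  subst hn
  have hmem : ∀ i, 1 ≤ l.get i ∧ l.get i ≤ l.length := fun i =>
    Finset.mem_Icc.mp ((mem_of_mem_arrangements hl).mp (l.get_mem i))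
  have hnd : l.Nodup := by
    rw [← Multiset.coe_nodup, ← mem_arrangements.mp hl]
    exact Finset.nodup _
  let f : Fin l.length → Fin l.length := fun i => ⟨l.get i - 1, by have := hmem i; omega⟩
  have hf : Function.Injective f := by
    intro i j h
    have h1 : l.get i - 1 = l.get j - 1 := congrArg Fin.val h
    have := hmem i
    have := hmem j
    exact List.nodup_iff_injective_get.mp hnd (by omega)
  refine ⟨Equiv.ofBijective f (Finite.injective_iff_bijective.mp hf), ?_⟩
  have : (fun i => ((Equiv.ofBijective f (Finite.injective_iff_bijective.mp hf)) i : ℕ) + 1) =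
      l.get := by
    funext i
    have := hmem i
    change l.get i - 1 + 1 = l.get i
    omega
  rw [permWord, this, List.ofFn_get]

/-- Indexes each triple by its middle position; a range of length `m + 2` has `m` of these. -/
theorem tripleCount_map_range' (p : ℕ → ℕ → ℕ → Prop) [∀ a b c, Decidable (p a b c)] (g : ℕ → ℕ)
    (m : ℕ) : ∀ s, tripleCount p ((List.range' s (m + 2)).map g) =
      ((Finset.Icc (s + 1) (s + m)).filter fun i => p (g (i - 1)) (g i) (g (i + 1))).card := by
  induction m with
  | zero => intro s; simp [List.range', tripleCount]
  | succ m ih =>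
    intro s
    have h := ih (s + 1)
    rw [Finset.card_filter] at h ⊢
    rw [show Finset.Icc (s + 1) (s + (m + 1)) =
      insert (s + 1) (Finset.Icc (s + 1 + 1) (s + 1 + m)) by ext; simp; omega,
      Finset.sum_insert (by simp), ← h]
    rfl

theorem cons_permWord_append {n : ℕ} (σ : Equiv.Perm (Fin n)) :
    0 :: (permWord σ ++ [0]) = (List.range' 0 (n + 2)).map (letter σ) := by
  apply List.ext_getElem
  · simp [permWord]
  · intro i h1 h2
    rw [List.getElem_map, List.getElem_range']
    cases i with
    | zero => simp [letter]
    | succ i =>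
      rw [List.getElem_cons_succ]
      by_cases hi : i < n
      · rw [List.getElem_append_left (by simpa [permWord] using hi)]
        simp only [permWord, List.getElem_ofFn, letter]
        rw [dif_pos (by omega)]
        simp
      · have : i = n := by simp [permWord] at h1; omega
        subst this
        rw [List.getElem_append_right (by simp [permWord])]
        simp [letter]

theorem tripleCount_permWord (p : ℕ → ℕ → ℕ → Prop) [∀ a b c, Decidable (p a b c)] {n : ℕ}
    (σ : Equiv.Perm (Fin n)) : tripleCount p (0 :: (permWord σ ++ [0])) =
      ((Finset.Icc 1 n).filter fun i =>
        p (letter σ (i - 1)) (letter σ i) (letter σ (i + 1))).card := by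
  rw [cons_permWord_append, tripleCount_map_range', zero_add, zero_add]

/-- The threshold is kept general because reading the first letter may raise it. -/
theorem lmaWord_ofFn {n : ℕ} (f : Fin n → ℕ) : ∀ m, lmaWord m (List.ofFn f) =
    (Finset.univ.filter fun i : Fin n => m < f i ∧ ∀ j, j < i → f j < f i).card := by
  induction n with
  | zero => intro m; simp [lmaWord]
  | succ n ih =>
    intro m
    rw [List.ofFn_succ, lmaWord, ih, Finset.card_filter, Finset.card_filter, Fin.sum_univ_succ]
    congr 1
    · simp
    · refine Finset.sum_congr rfl fun i _ => ?_
      simp only [Fin.forall_fin_succ, Fin.succ_pos, Fin.succ_lt_succ_iff, max_lt_iff, and_assoc,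
        forall_const]

theorem rmaWord_ofFn {n : ℕ} (f : Fin n → ℕ) : rmaWord (List.ofFn f) =
    (Finset.univ.filter fun i : Fin n => ∀ j, i < j → f j < f i).card := by
  induction n with
  | zero => simp [rmaWord]
  | succ n ih =>
    rw [List.ofFn_succ, rmaWord, ih, Finset.card_filter, Finset.card_filter, Fin.sum_univ_succ]
    congr 1
    · simp [Fin.forall_fin_succ, List.mem_ofFn']
    · refine Finset.sum_congr rfl fun i _ => ?_
      simp [Fin.forall_fin_succ]

theorem countP_ofFn_lt {n : ℕ} (f : Fin n → ℕ) (c : ℕ) :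
    (List.ofFn f).countP (· < c) = ∑ j, if f j < c then 1 else 0 := by
  induction n with
  | zero => simp
  | succ n ih =>
    rw [List.ofFn_succ, List.countP_cons, ih, Fin.sum_univ_succ, add_comm]
    simp

theorem invWord_ofFn {n : ℕ} (f : Fin n → ℕ) : invWord (List.ofFn f) =
    (Finset.univ.filter fun p : Fin n × Fin n => p.1 < p.2 ∧ f p.2 < f p.1).card := by
  rw [Finset.card_filter, Fintype.sum_prod_type]
  induction n with
  | zero => simp [invWord]
  | succ n ih =>
    rw [List.ofFn_succ, invWord, ih, Fin.sum_univ_succ, countP_ofFn_lt]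
    congr 1
    · rw [Fin.sum_univ_succ]
      simp
    · refine Finset.sum_congr rfl fun i _ => ?_
      rw [Fin.sum_univ_succ]
      simp

theorem P_eq_sum_wordWeight {K : Type*} [Field K] (n : ℕ) (u₁ u₂ u₃ u₄ α β q : K) :
    P n u₁ u₂ u₃ u₄ α β q =
      ∑ l ∈ arrangements (Finset.Icc 1 n), wordWeight u₁ u₂ u₃ u₄ α β q l := by
  refine Finset.sum_bij (fun σ _ => permWord σ) (fun σ _ => permWord_mem_arrangements σ)
    (fun σ _ τ _ h => permWord_injective h) (fun l hl => ?_) fun σ _ => ?_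
  · obtain ⟨σ, h⟩ := exists_permWord_eq hl
    exact ⟨σ, Finset.mem_univ _, h⟩
  · have hl : lmaWord 0 (permWord σ) = lma σ := by
      rw [permWord, lmaWord_ofFn, lma]
      simp
    have hr : rmaWord (permWord σ) = rma σ := by
      rw [permWord, rmaWord_ofFn, rma]
      simp
    have hi : invWord (permWord σ) = inv σ := by
      rw [permWord, invWord_ofFn, inv]
      simp
    rw [wordWeight, tripleCount_permWord, tripleCount_permWord, tripleCount_permWord,
      tripleCount_permWord, hl, hr, hi]
    rfl

/-! ### The generating function -/

theorem qEGF_P_eq {K : Type*} [Field K] {q : K} (hq : ∀ n, 0 < n → q ^ n ≠ 1)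
    {u₁ u₂ u₃ u₄ α β : K} {Φ A B : K⟦X⟧} (hΦ : constantCoeff Φ = 0)
    (hΦ' : qDeriv q Φ = C u₁ + C u₄ * rescale q Φ + C u₃ * Φ + C u₂ * Φ * rescale q Φ)
    (hA : constantCoeff A = 1) (hA' : qDeriv q A = C α * A * (C u₃ + C u₂ * rescale q Φ))
    (hB : constantCoeff B = 1) (hB' : qDeriv q B = C β * (C u₄ + C u₂ * Φ) * rescale q B) :
    qEGF q (fun n => P (n + 1) u₁ u₂ u₃ u₄ α β q) = A * rescale q B := by
  ext n
  rw [qEGF, coeff_mk, P_eq_sum_wordWeight, show Finset.Icc 1 (n + 1) =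
      insert (n + 1) (Finset.Icc 1 n) by ext; simp; omega,
    sum_wordWeight (by simpa using hq 1 one_pos) hΦ hΦ' hA hA' hB hB'
      (fun x hx => by have := Finset.mem_Icc.mp hx; omega) n.succ_pos
      (fun x hx => (Finset.mem_Icc.mp hx).1), Nat.card_Icc, Nat.add_sub_cancel,
    mul_div_cancel_left₀ _ (qFactorial_ne_zero hq n)]

theorem ratFunc_X_pow_ne_one (k : Type*) [Field k] (n : ℕ) (hn : 0 < n) :
    (RatFunc.X : RatFunc k) ^ n ≠ 1 := by
  intro h
  have h1 := congrArg (valZero k) h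
  rw [map_pow, map_one, valZero, Polynomial.valuation_X_eq_neg_one] at h1
  exact (pow_lt_one₀ zero_le (WithZero.exp_lt_exp.mpr (by decide : (-1 : ℤ) < 0)) hn.ne').ne h1

end StirlingEulerian

end

theorem theorem5 {k : Type*} [Field k] [CharZero k]
    (x y u₁ u₂ u₃ u₄ α β : RatFunc k) (hne : x ≠ y)
    (hadd : x + y = u₃ + u₄) (hmul : x * y = u₁ * u₂) :
    ∃ I J : PowerSeries (RatFunc k),
      StirlingEulerian.IsJacksonIntegral (StirlingEulerian.valZero k) RatFunc.X
        (StirlingEulerian.integrand₁ x y u₁ u₂ u₃ u₄ α RatFunc.X) I ∧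
      StirlingEulerian.IsJacksonIntegral (StirlingEulerian.valInfty k) (RatFunc.X)⁻¹
        (StirlingEulerian.integrand₂ x y u₁ u₂ u₃ u₄ β RatFunc.X) J ∧
      StirlingEulerian.qEGF RatFunc.X
          (fun n => StirlingEulerian.P (n + 1) u₁ u₂ u₃ u₄ α β RatFunc.X) =
        (PowerSeries.exp (RatFunc k)).subst (I + J) := by
  classical
  have hq := StirlingEulerian.ratFunc_X_pow_ne_one k
  have hq0 : (RatFunc.X : RatFunc k) ≠ 0 := RatFunc.X_ne_zero
  have hlt : (WithZero.exp (-1) : WithZero (Multiplicative ℤ)) < 1 :=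
    WithZero.exp_lt_exp.mpr (by decide : (-1 : ℤ) < 0)
  refine ⟨StirlingEulerian.jacksonIntegral RatFunc.X _,
    StirlingEulerian.jacksonIntegral (RatFunc.X)⁻¹ _,
    StirlingEulerian.isJacksonIntegral_jacksonIntegral _ ?_ hq _,
    StirlingEulerian.isJacksonIntegral_jacksonIntegral _ ?_
      (StirlingEulerian.inv_pow_ne_one hq) _, ?_⟩
  · rw [StirlingEulerian.valZero, Polynomial.valuation_X_eq_neg_one]
    exact hlt
  · rw [StirlingEulerian.valInfty, ← one_div, RatFunc.inftyValuation.X_inv]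
    exact hlt
  · have hI0 := StirlingEulerian.constantCoeff_jacksonIntegral RatFunc.X
      (StirlingEulerian.integrand₁ x y u₁ u₂ u₃ u₄ α RatFunc.X)
    have hJ0 := StirlingEulerian.constantCoeff_jacksonIntegral (RatFunc.X)⁻¹
      (StirlingEulerian.integrand₂ x y u₁ u₂ u₃ u₄ β RatFunc.X)
    -- With `B` the exponential of `J` at `t/q`, the factor `B(qt)` is exactly that exponential at
    -- `t`.
    rw [StirlingEulerian.qEGF_P_eq hq (StirlingEulerian.constantCoeff_F u₁ x y u₄ RatFunc.X)
        (StirlingEulerian.qDeriv_F hq hne hadd hmul)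
        (StirlingEulerian.constantCoeff_exp_subst hI0)
        (StirlingEulerian.qDeriv_exp_integrand₁ hq x y u₁ u₂ u₃ u₄ α)
        (by rw [StirlingEulerian.constantCoeff_rescale,
          StirlingEulerian.constantCoeff_exp_subst hJ0])
        (StirlingEulerian.qDeriv_exp_integrand₂ hq0 hq u₁ u₂ β hne hadd),
      StirlingEulerian.exp_subst_add hI0 hJ0, PowerSeries.rescale_rescale, inv_mul_cancel₀ hq0,
      PowerSeries.rescale_one, RingHom.id_apply]
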